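/- Let $\theta,\rho\in\mathbb{R}$ with $|\theta|<1$ and $|\rho|<1$, and let $(V_n)_{n\ge 1}$ be a sequence of independent and identically distributed real random variables with $\mathbb{E}[V_1]=0$, variance $\sigma^2=\mathbb{E}[V_1^2]>0$ and finite fourth moment $\mathbb{E}[V_1^4]<\infty$. Let $X_0$ and $\varepsilon_0$ be arbitrary real random variables on the same probability space, and define, for all $n\ge 1$, $$X_n=\theta X_{n-1}+\varepsilon_n,\qquad \varepsilon_n=\rho\,\varepsilon_{n-1}+V_n .$$ For $n\ge 1$ let $$\widehat{\theta}_n=\frac{\sum_{k=1}^n X_kX_{k-1}}{\sum_{k=1}^n X_{k-1}^2}$$ be the least squares estimator of $\theta$ (with the value $0$, say, where the denominator vanishes), and set $$\theta^*=\frac{\theta+\rho}{1+\theta\rho},\qquad \sigma_\theta^2=\frac{(1-\theta^2)(1-\theta\rho)(1-\rho^2)}{(1+\theta\rho)^3}.$$ Then, as $n\to\infty$, $\sqrt{n}\,(\widehat{\theta}_n-\theta^*)$ converges in law to the normal distribution $\mathcal{N}(0,\sigma_\theta^2)$. -/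

import Mathlib

open MeasureTheory ProbabilityTheory Filter

/-- The limiting value `θ* = (θ + ρ) / (1 + θρ)`. -/
noncomputable def thetaStar (θ ρ : ℝ) : ℝ := (θ + ρ) / (1 + θ * ρ)

/-- The asymptotic variance `σ_θ² = (1 - θ²)(1 - θρ)(1 - ρ²) / (1 + θρ)³`. -/
noncomputable def sigmaThetaSq (θ ρ : ℝ) : ℝ :=
  (1 - θ ^ 2) * (1 - θ * ρ) * (1 - ρ ^ 2) / (1 + θ * ρ) ^ 3

/-- The least squares estimator of the autoregressive parameter computed from the
observations `x 0, …, x n`. -/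
noncomputable def thetaHat (x : ℕ → ℝ) (n : ℕ) : ℝ :=
  (∑ k ∈ Finset.Icc 1 n, x k * x (k - 1)) / ∑ k ∈ Finset.Icc 1 n, x (k - 1) ^ 2

/-- The asymptotic variance is positive, so that `Real.toNNReal` does not truncate it. -/
theorem sigmaThetaSq_pos {θ ρ : ℝ} (hθ : |θ| < 1) (hρ : |ρ| < 1) : 0 < sigmaThetaSq θ ρ := by
  have h1 : θ ^ 2 < 1 := (sq_lt_one_iff_abs_lt_one θ).2 hθ
  have h2 : ρ ^ 2 < 1 := (sq_lt_one_iff_abs_lt_one ρ).2 hρ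
  have h3 : |θ * ρ| < 1 := by
    rw [abs_mul]
    nlinarith [abs_nonneg θ, abs_nonneg ρ]
  obtain ⟨h4, h5⟩ := abs_lt.1 h3
  have a : 0 < 1 - θ ^ 2 := by linarith
  have b : 0 < 1 - ρ ^ 2 := by linarith
  have c : 0 < 1 - θ * ρ := by linarith
  have d : 0 < 1 + θ * ρ := by linarith
  unfold sigmaThetaSq
  positivity

/-!
Asymptotic normality of the least squares estimator of an autoregressive process with
autoregressive noise.

Write `P n = ∑ X (k + 1) X k` and `S n = ∑ X k ^ 2` for the numerator and the denominator of the
estimator. The process solves `X (k + 1) = (θ + ρ) X k - θ ρ X (k - 1) + V (k + 1)`, and summing this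
against `X k` gives (`sum_mul_succ_eq`)
`(1 + θ ρ) (P n - θ* S n) = ∑ X k V (k + 1) + boundary terms`.
So everything rests on the martingale transform `∑ X k V (k + 1)` and on the growth of `S n`.

The initial values may depend on the noise, so `X` is first compared with the process `Y` started
from zero (`arFilter`): the difference decays geometrically along each path, and contributes nothing
after normalization (`tendsto_initial_value_terms`). For `Y`, whose value at time `k` only involves
the noise strictly before the draw number `k`, two limit theorems are needed.

* `S n / n → ℓ = Var V (1 + θ ρ) / ((1 - θ²) (1 - θ ρ) (1 - ρ²))` in probability: squaring the two
  recursions expresses `∑ Y²` through `∑ V²` and martingale transforms, which are `o(n)` because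
  their terms are orthogonal (`IsInnovation.tendstoInMeasure_average_arFilter_sq`).
* A central limit theorem for martingale transforms (`IsInnovation.tendstoInDistribution_sum`). With
  the coefficients truncated as soon as their sum of squares exceeds `(ℓ + 1) n`, the process
  `exp (i s ∑ Y V + s² Var V / 2 · ∑ Y²)`, `s = t / √n`, is bounded. Its expectation would be
  constant if `V` were Gaussian; in general each step changes it by at most the error of the Gaussian
  approximation of the characteristic function of `V` at `s Y k`, which is `O(n ^ (-3/2))` by the
  fourth moment bounds. As `∑ Y² / n` is asymptotically deterministic, the characteristic function of
  `n ^ (-1/2) ∑ Y V` converges to the Gaussian one, and Lévy's theorem applies.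

Slutsky's theorem combines the two.
-/

open scoped Topology ENNReal

/-! ### Convergence in probability -/

section ConvergenceInMeasure

variable {Ω : Type*} [MeasurableSpace Ω] {μ : Measure Ω}

theorem tendstoInMeasure_continuousAt_comp {E E' : Type*} [PseudoMetricSpace E]
    [PseudoMetricSpace E'] {f : ℕ → Ω → E} {a : E} {φ : E → E'}
    (hf : TendstoInMeasure μ f atTop (fun _ => a)) (hφ : ContinuousAt φ a) :
    TendstoInMeasure μ (fun n ω => φ (f n ω)) atTop (fun _ => φ a) := by
  rw [tendstoInMeasure_iff_dist] at hf ⊢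
  intro ε hε
  obtain ⟨δ, hδ, h⟩ := Metric.continuousAt_iff.1 hφ ε hε
  refine tendsto_of_tendsto_of_tendsto_of_le_of_le tendsto_const_nhds (hf δ hδ)
    (fun _ => zero_le) fun n => measure_mono fun ω hω => ?_
  simp only [Set.mem_ofPred_eq] at hω ⊢
  by_contra! hlt
  exact absurd (h hlt) (not_lt.2 hω)

theorem tendstoInMeasure_continuousAt_comp₂ {f g : ℕ → Ω → ℝ} {a b : ℝ} {φ : ℝ → ℝ → ℝ}
    (hf : TendstoInMeasure μ f atTop (fun _ => a))
    (hg : TendstoInMeasure μ g atTop (fun _ => b))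
    (hφ : ContinuousAt (fun p : ℝ × ℝ => φ p.1 p.2) (a, b)) :
    TendstoInMeasure μ (fun n ω => φ (f n ω) (g n ω)) atTop (fun _ => φ a b) := by
  rw [tendstoInMeasure_iff_dist] at hf hg ⊢
  intro ε hε
  obtain ⟨δ, hδ, hc⟩ := Metric.continuousAt_iff.1 hφ ε hε
  have h := (hf δ hδ).add (hg δ hδ)
  rw [add_zero] at h
  refine tendsto_of_tendsto_of_tendsto_of_le_of_le tendsto_const_nhds h
    (fun _ => zero_le) fun n => (measure_mono fun ω hω => ?_).trans (measure_union_le _ _)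
  simp only [Set.mem_ofPred_eq, Set.mem_union] at hω ⊢
  by_contra! hlt
  exact absurd (@hc (f n ω, g n ω) (max_lt hlt.1 hlt.2)) (not_lt.2 hω)

theorem tendstoInMeasure_add_const {f g : ℕ → Ω → ℝ} {a b : ℝ}
    (hf : TendstoInMeasure μ f atTop (fun _ => a))
    (hg : TendstoInMeasure μ g atTop (fun _ => b)) :
    TendstoInMeasure μ (fun n ω => f n ω + g n ω) atTop (fun _ => a + b) :=
  tendstoInMeasure_continuousAt_comp₂ (φ := fun x y => x + y) hf hg (by fun_prop)

theorem tendstoInMeasure_const_mul {f : ℕ → Ω → ℝ} {a : ℝ}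
    (hf : TendstoInMeasure μ f atTop (fun _ => a)) (c : ℝ) :
    TendstoInMeasure μ (fun n ω => c * f n ω) atTop (fun _ => c * a) :=
  tendstoInMeasure_continuousAt_comp (φ := fun x : ℝ => c * x) hf (by fun_prop)

/-- By Markov's inequality, a sequence bounded in `L¹` times a null sequence of reals tends to
zero in probability. -/
theorem tendstoInMeasure_mul_of_integral_abs_le {a : ℕ → ℝ} (ha : Tendsto a atTop (𝓝 0))
    {f : ℕ → Ω → ℝ} {K : ℝ} (hf : ∀ n, Integrable (f n) μ) (hK : ∀ n, ∫ ω, |f n ω| ∂μ ≤ K) :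
    TendstoInMeasure μ (fun n ω => a n * f n ω) atTop (fun _ => 0) := by
  refine tendstoInMeasure_of_tendsto_eLpNorm (p := 1) one_ne_zero
    (fun n => ((hf n).const_mul _).aestronglyMeasurable) aestronglyMeasurable_const ?_
  have hb : ∀ n, eLpNorm ((fun ω => a n * f n ω) - fun _ => 0) 1 μ ≤ ENNReal.ofReal (|a n| * K) := by
    intro n
    have : ((fun ω => a n * f n ω) - fun _ => (0 : ℝ)) = fun ω => a n * f n ω := by
      ext; simp
    rw [this, eLpNorm_one_eq_lintegral_enorm,
      ← ofReal_integral_norm_eq_lintegral_enorm ((hf n).const_mul _)]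
    refine ENNReal.ofReal_le_ofReal ?_
    simp only [norm_mul, Real.norm_eq_abs]
    rw [integral_const_mul]
    exact mul_le_mul_of_nonneg_left (hK n) (abs_nonneg _)
  refine tendsto_of_tendsto_of_tendsto_of_le_of_le tendsto_const_nhds ?_ (fun _ => zero_le) hb
  have : Tendsto (fun n => |a n| * K) atTop (𝓝 0) := by
    simpa using ha.abs.mul_const K
  simpa using ENNReal.tendsto_ofReal this

/-- A sequence bounded in `L¹` is almost surely summable against geometric weights. -/
theorem ae_summable_pow_mul_abs {f : ℕ → Ω → ℝ} {K r : ℝ} (hr0 : 0 ≤ r) (hr1 : r < 1)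
    (hf : ∀ n, Integrable (f n) μ) (hK : ∀ n, ∫ ω, |f n ω| ∂μ ≤ K) :
    ∀ᵐ ω ∂μ, Summable (fun k => r ^ k * |f k ω|) := by
  have hint : ∀ k, Integrable (fun ω => r ^ k * |f k ω|) μ := fun k => (hf k).abs.const_mul _
  have hsum : ∑' k, ∫⁻ ω, ‖r ^ k * |f k ω|‖ₑ ∂μ ≠ ∞ := by
    have hle : ∀ k, ∫⁻ ω, ‖r ^ k * |f k ω|‖ₑ ∂μ ≤ ENNReal.ofReal (r ^ k * K) := by
      intro k
      rw [← ofReal_integral_norm_eq_lintegral_enorm (hint k)]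
      refine ENNReal.ofReal_le_ofReal ?_
      simp only [norm_mul, Real.norm_eq_abs, abs_abs, abs_pow, abs_of_nonneg hr0]
      rw [integral_const_mul]
      exact mul_le_mul_of_nonneg_left (hK k) (pow_nonneg hr0 _)
    refine ne_top_of_le_ne_top ?_ (ENNReal.tsum_le_tsum hle)
    exact ((summable_geometric_of_lt_one hr0 hr1).mul_right K).tsum_ofReal_ne_top
  rw [← lintegral_tsum (fun k => (hint k).aestronglyMeasurable.enorm)] at hsum
  filter_upwards [ae_lt_top' (AEMeasurable.tsum
    fun k => (hint k).aestronglyMeasurable.enorm) hsum] with ω hω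
  have : Summable (fun k => ‖r ^ k * |f k ω|‖₊) := ENNReal.tsum_coe_ne_top_iff_summable.1 hω.ne
  exact (NNReal.summable_coe.2 this).of_norm

/-- Bounded convergence: convergence in probability to a constant of uniformly bounded random
variables entails convergence of the integrals. -/
theorem tendsto_integral_zero_of_norm_le_of_tendstoInMeasure [IsProbabilityMeasure μ] {f : ℕ → Ω → ℂ} {B : ℝ}
    (hf : ∀ n, AEStronglyMeasurable (f n) μ) (hB : ∀ n ω, ‖f n ω‖ ≤ B)
    (h : TendstoInMeasure μ f atTop (fun _ => 0)) :
    Tendsto (fun n => ∫ ω, f n ω ∂μ) atTop (𝓝 0) := by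
  refine tendsto_of_subseq_tendsto fun ns hns => ?_
  obtain ⟨ms, -, hms⟩ := (h.comp hns).exists_seq_tendsto_ae
  refine ⟨ms, ?_⟩
  have := tendsto_integral_of_dominated_convergence (μ := μ) (fun _ => B)
    (fun n => hf (ns (ms n))) (integrable_const B)
    (fun n => ae_of_all _ fun ω => hB (ns (ms n)) ω) hms
  simpa using this

end ConvergenceInMeasure

/-! ### Gaussian approximation of characteristic functions -/

section CharacteristicFunction

theorem norm_exp_mul_I_sub_taylor_two_le (x : ℝ) :
    ‖Complex.exp (x * Complex.I) - 1 - x * Complex.I + (x : ℂ) ^ 2 / 2‖ ≤ 4 * |x| ^ 3 := by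
  have hn : ‖(x : ℂ) * Complex.I‖ = |x| := by simp
  rcases le_or_gt |x| 1 with h | h
  · have := Complex.exp_bound (x := x * Complex.I) (by rwa [hn]) (n := 3) (by norm_num)
    rw [hn] at this
    have e : Complex.exp (x * Complex.I) - 1 - x * Complex.I + (x : ℂ) ^ 2 / 2 =
        Complex.exp (x * Complex.I) -
          ∑ m ∈ Finset.range 3, ((x : ℂ) * Complex.I) ^ m / m.factorial := by
      simp [Finset.sum_range_succ, Nat.factorial, mul_pow]
      ring
    rw [e]
    refine this.trans ?_
    norm_num [Nat.factorial]
    nlinarith [pow_nonneg (abs_nonneg x) 3]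
  · have h1 : ‖Complex.exp (x * Complex.I)‖ = 1 := Complex.norm_exp_ofReal_mul_I x
    have h2 : ‖(x : ℂ) ^ 2 / 2‖ = |x| ^ 2 / 2 := by simp
    have h3 : ‖Complex.exp (x * Complex.I) - 1 - x * Complex.I + (x : ℂ) ^ 2 / 2‖ ≤
        1 + 1 + |x| + |x| ^ 2 / 2 := by
      refine (norm_add_le _ _).trans ?_
      rw [h2]
      gcongr
      refine (norm_sub_le _ _).trans ?_
      rw [hn]
      gcongr
      refine (norm_sub_le _ _).trans ?_
      rw [h1]
      simp
    refine h3.trans ?_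
    have a : |x| ≤ |x| ^ 3 := le_self_pow₀ h.le (by norm_num)
    have b : |x| ^ 2 ≤ |x| ^ 3 := pow_le_pow_right₀ h.le (by norm_num)
    linarith

theorem abs_exp_neg_sub_one_add_le {y : ℝ} (hy : 0 ≤ y) : |Real.exp (-y) - 1 + y| ≤ y ^ 2 := by
  have h1 : 0 ≤ Real.exp (-y) - 1 + y := by linarith [Real.add_one_le_exp (-y)]
  rw [abs_of_nonneg h1]
  rcases le_or_gt y 1 with h | h
  · have := Real.norm_exp_sub_one_sub_id_le (x := -y) (by rwa [norm_neg, Real.norm_of_nonneg hy])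
    rw [norm_neg, Real.norm_eq_abs, Real.norm_eq_abs, sq_abs] at this
    have := (abs_le.1 this).2
    linarith
  · have : Real.exp (-y) ≤ 1 := Real.exp_le_one_iff.2 (by linarith)
    nlinarith

/-- The characteristic function of a centred law with a finite fourth moment agrees with that of
the Gaussian law of the same variance up to a cubic and a quartic term. The bound holds at all
arguments, not only near the origin. -/
theorem exists_norm_charFun_sub_exp_le {ν : Measure ℝ} [IsProbabilityMeasure ν]
    (h4 : MemLp id 4 ν) (h0 : ∫ x, x ∂ν = 0) :
    ∃ K, 0 ≤ K ∧ ∀ u : ℝ,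
      ‖charFun ν u - Complex.exp (-(((∫ x, x ^ 2 ∂ν) * u ^ 2 / 2 : ℝ) : ℂ))‖ ≤
        K * (|u| ^ 3 + u ^ 4) := by
  set v : ℝ := ∫ x, x ^ 2 ∂ν with hv
  have i1 : Integrable (fun x : ℝ => x) ν :=
    h4.integrable (by norm_num)
  have i2 : Integrable (fun x : ℝ => x ^ 2) ν :=
    (h4.mono_exponent (p := 2) (by norm_num)).integrable_sq
  have i3 : Integrable (fun x : ℝ => |x| ^ 3) ν := by
    simpa using (h4.mono_exponent (p := (3 : ℕ)) (by norm_num)).integrable_norm_pow (by norm_num)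
  have hv0 : 0 ≤ v := integral_nonneg fun x => sq_nonneg x
  have hm0 : 0 ≤ ∫ x, |x| ^ 3 ∂ν := integral_nonneg fun x => by positivity
  refine ⟨4 * (∫ x, |x| ^ 3 ∂ν) + v ^ 2 / 4, by positivity, fun u => ?_⟩
  have c1 : ‖charFun ν u - 1 + ((v * u ^ 2 / 2 : ℝ) : ℂ)‖ ≤ 4 * (∫ x, |x| ^ 3 ∂ν) * |u| ^ 3 := by
    have ie : Integrable (fun x : ℝ => Complex.exp (((u * x : ℝ) : ℂ) * Complex.I)) ν := by
      refine Integrable.of_bound (by fun_prop) 1 (ae_of_all _ fun x => ?_)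
      rw [Complex.norm_exp_ofReal_mul_I]
    have j1 : Integrable (fun x : ℝ => ((u * x : ℝ) : ℂ) * Complex.I) ν :=
      ((i1.const_mul u).ofReal).mul_const _
    have j2 : Integrable (fun x : ℝ => ((u * x : ℝ) : ℂ) ^ 2 / 2) ν := by
      have : Integrable (fun x : ℝ => ((u ^ 2 / 2 * x ^ 2 : ℝ) : ℂ)) ν :=
        (i2.const_mul (u ^ 2 / 2)).ofReal
      refine this.congr (ae_of_all _ fun x => ?_)
      push_cast
      ring
    have e : charFun ν u - 1 + ((v * u ^ 2 / 2 : ℝ) : ℂ) =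
        ∫ x, (Complex.exp (((u * x : ℝ) : ℂ) * Complex.I) - 1 - ((u * x : ℝ) : ℂ) * Complex.I
          + ((u * x : ℝ) : ℂ) ^ 2 / 2) ∂ν := by
      have k1 : Integrable
          (fun x : ℝ => Complex.exp (((u * x : ℝ) : ℂ) * Complex.I) - 1) ν :=
        ie.sub (integrable_const _)
      have k2 : Integrable (fun x : ℝ => Complex.exp (((u * x : ℝ) : ℂ) * Complex.I) - 1
          - ((u * x : ℝ) : ℂ) * Complex.I) ν := k1.sub j1
      rw [integral_add k2 j2, integral_sub k1 j1, integral_sub ie (integrable_const _),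
        integral_mul_const, integral_complex_ofReal, integral_const_mul, h0]
      have : ∫ x : ℝ, ((u * x : ℝ) : ℂ) ^ 2 / 2 ∂ν = ((v * u ^ 2 / 2 : ℝ) : ℂ) := by
        have : (fun x : ℝ => ((u * x : ℝ) : ℂ) ^ 2 / 2) =
            fun x : ℝ => ((u ^ 2 / 2 * x ^ 2 : ℝ) : ℂ) := by
          ext x
          push_cast
          ring
        rw [this, integral_complex_ofReal, integral_const_mul, ← hv]
        congr 1
        ring
      rw [this, charFun_apply_real]
      simp
    rw [e]
    refine (norm_integral_le_integral_norm _).trans ?_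
    have : 4 * (∫ x, |x| ^ 3 ∂ν) * |u| ^ 3 = ∫ x, 4 * |u| ^ 3 * |x| ^ 3 ∂ν := by
      rw [integral_const_mul]
      ring
    rw [this]
    refine integral_mono_of_nonneg (ae_of_all _ fun x => norm_nonneg _) (i3.const_mul _)
      (ae_of_all _ fun x => ?_)
    refine (norm_exp_mul_I_sub_taylor_two_le (u * x)).trans_eq ?_
    simp only [abs_mul, mul_pow, mul_assoc]
  have c2 : ‖Complex.exp (-((v * u ^ 2 / 2 : ℝ) : ℂ)) - 1 + ((v * u ^ 2 / 2 : ℝ) : ℂ)‖ ≤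
      v ^ 2 / 4 * u ^ 4 := by
    have e : Complex.exp (-((v * u ^ 2 / 2 : ℝ) : ℂ)) - 1 + ((v * u ^ 2 / 2 : ℝ) : ℂ) =
        ((Real.exp (-(v * u ^ 2 / 2)) - 1 + v * u ^ 2 / 2 : ℝ) : ℂ) := by
      push_cast
      ring
    rw [e, Complex.norm_real, Real.norm_eq_abs]
    refine (abs_exp_neg_sub_one_add_le (by positivity)).trans_eq ?_
    ring
  have e : charFun ν u - Complex.exp (-((v * u ^ 2 / 2 : ℝ) : ℂ)) =
      (charFun ν u - 1 + ((v * u ^ 2 / 2 : ℝ) : ℂ)) -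
      (Complex.exp (-((v * u ^ 2 / 2 : ℝ) : ℂ)) - 1 + ((v * u ^ 2 / 2 : ℝ) : ℂ)) := by ring
  rw [e]
  refine (norm_sub_le _ _).trans ((add_le_add c1 c2).trans ?_)
  have p3 : 0 ≤ |u| ^ 3 := by positivity
  have p4 : 0 ≤ u ^ 4 := by positivity
  nlinarith [mul_nonneg hm0 p4, mul_nonneg (sq_nonneg v) p3]

end CharacteristicFunction

/-! ### Innovation sequences -/

section Innovation

variable {Ω : Type*} [mΩ : MeasurableSpace Ω] {μ : Measure Ω}

/-- `ξ` is a centred i.i.d. innovation sequence for the filtration `F`, with a finite fourth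
moment: `ξ k` is independent of `F k` and known at time `k + 1`. Thus `F k` stands for the
information available strictly before `ξ k` is drawn, and "predictable" coefficients of `ξ k` are
the `F k`-measurable ones. -/
structure IsInnovation (F : Filtration ℕ mΩ) (ξ : ℕ → Ω → ℝ) (μ : Measure Ω) : Prop where
  measurable_succ : ∀ k, Measurable[F (k + 1)] (ξ k)
  indep : ∀ k, Indep (F k) (MeasurableSpace.comap (ξ k) inferInstance) μ
  identDistrib : ∀ k, IdentDistrib (ξ k) (ξ 0) μ μ
  memLp_four : MemLp (ξ 0) 4 μ
  integral_eq_zero : ∫ ω, ξ 0 ω ∂μ = 0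

namespace IsInnovation

variable {F : Filtration ℕ mΩ} {ξ : ℕ → Ω → ℝ}

theorem measurable (h : IsInnovation F ξ μ) (k : ℕ) : Measurable (ξ k) :=
  (h.measurable_succ k).mono (F.le _) le_rfl

theorem indepFun (h : IsInnovation F ξ μ) {β : Type*} [MeasurableSpace β] {k : ℕ} {f : Ω → β}
    (hf : Measurable[F k] f) : IndepFun f (ξ k) μ := by
  rw [IndepFun_iff_Indep]
  exact indep_of_indep_of_le_left (h.indep k) hf.comap_le

end IsInnovation

/-- Freezing lemma: conditionally on a random element `P`, an independent variable `ξ` contributes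
its characteristic function. -/
theorem integral_mul_exp_eq_integral_mul_charFun {E : Type*} [MeasurableSpace E]
    [IsProbabilityMeasure μ] {P : Ω → E} {ξ : Ω → ℝ} (hP : Measurable P) (hξ : Measurable ξ)
    (hind : IndepFun P ξ μ) {A : E → ℂ} {w : E → ℝ} {B : ℝ} (hA : Measurable A)
    (hw : Measurable w) (hB : ∀ ω, ‖A (P ω)‖ ≤ B) :
    ∫ ω, A (P ω) * Complex.exp (((w (P ω) * ξ ω : ℝ) : ℂ) * Complex.I) ∂μ =
      ∫ ω, A (P ω) * charFun (μ.map ξ) (w (P ω)) ∂μ := by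
  have : IsProbabilityMeasure (μ.map P) := Measure.isProbabilityMeasure_map hP.aemeasurable
  have : IsProbabilityMeasure (μ.map ξ) := Measure.isProbabilityMeasure_map hξ.aemeasurable
  set G : E × ℝ → ℂ := fun p => A p.1 * Complex.exp (((w p.1 * p.2 : ℝ) : ℂ) * Complex.I)
  have hG : Measurable G := by fun_prop
  have hmap := (indepFun_iff_map_prod_eq_prod_map_map hP.aemeasurable hξ.aemeasurable).1 hind
  have hGi : Integrable G ((μ.map P).prod (μ.map ξ)) := by
    rw [← hmap, integrable_map_measure hG.aestronglyMeasurable (by fun_prop)]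
    refine Integrable.of_bound (hG.comp (hP.prodMk hξ)).aestronglyMeasurable B
      (ae_of_all _ fun ω => ?_)
    simp only [G, Function.comp, norm_mul, Complex.norm_exp_ofReal_mul_I, mul_one]
    exact hB ω
  calc ∫ ω, A (P ω) * Complex.exp (((w (P ω) * ξ ω : ℝ) : ℂ) * Complex.I) ∂μ
      = ∫ p, G p ∂((μ.map P).prod (μ.map ξ)) := by
        rw [← hmap, integral_map (by fun_prop) hG.aestronglyMeasurable]
    _ = ∫ x, A x * charFun (μ.map ξ) (w x) ∂(μ.map P) := by
        rw [integral_prod _ hGi]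
        refine integral_congr_ae (ae_of_all _ fun x => ?_)
        simp only [G, charFun_apply_real]
        rw [integral_const_mul]
        push_cast
        rfl
    _ = _ := by
        rw [integral_map hP.aemeasurable (Measurable.aestronglyMeasurable (by fun_prop))]

end Innovation

/-! ### Truncation by the running sum of squares -/

section Truncation

/-- The sequence `u`, killed from the first time that its running sum of squares, the current term
included, exceeds `B`. -/
noncomputable def truncateSq (B : ℝ) (u : ℕ → ℝ) (k : ℕ) : ℝ :=
  if ∑ j ∈ Finset.range (k + 1), u j ^ 2 ≤ B then u k else 0

theorem abs_truncateSq_le (B : ℝ) (u : ℕ → ℝ) (k : ℕ) : |truncateSq B u k| ≤ |u k| := by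
  unfold truncateSq
  split_ifs <;> simp

theorem sum_truncateSq_sq_le {B : ℝ} (hB : 0 ≤ B) (u : ℕ → ℝ) (n : ℕ) :
    ∑ k ∈ Finset.range n, truncateSq B u k ^ 2 ≤ B := by
  induction n with
  | zero => simpa
  | succ n ih =>
    by_cases h : ∑ j ∈ Finset.range (n + 1), u j ^ 2 ≤ B
    · refine le_trans (Finset.sum_le_sum fun k _ => ?_) h
      exact sq_le_sq.2 (abs_truncateSq_le B u k)
    · rw [Finset.sum_range_succ]
      simpa [truncateSq, h] using ih

theorem truncateSq_eq_of_sum_le {B : ℝ} {u : ℕ → ℝ} {n : ℕ}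
    (h : ∑ j ∈ Finset.range n, u j ^ 2 ≤ B) {k : ℕ} (hk : k < n) : truncateSq B u k = u k := by
  rw [truncateSq, if_pos]
  exact (Finset.sum_le_sum_of_subset_of_nonneg (Finset.range_mono hk)
    fun _ _ _ => sq_nonneg _).trans h

end Truncation

/-! ### The exponential process -/

section ExponentialProcess

variable {Ω : Type*}

/-- The exponential process `exp (i s ∑ Wⱼ ξⱼ + a ∑ Wⱼ²)` up to time `k`. For Gaussian `ξ` of
variance `2 a / s²` it would be a martingale. -/
noncomputable def expMart (s a : ℝ) (W ξ : ℕ → Ω → ℝ) (k : ℕ) (ω : Ω) : ℂ :=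
  Complex.exp (((s * ∑ j ∈ Finset.range k, W j ω * ξ j ω : ℝ) : ℂ) * Complex.I +
    ((a * ∑ j ∈ Finset.range k, W j ω ^ 2 : ℝ) : ℂ))

theorem norm_expMart (s a : ℝ) (W ξ : ℕ → Ω → ℝ) (k : ℕ) (ω : Ω) :
    ‖expMart s a W ξ k ω‖ = Real.exp (a * ∑ j ∈ Finset.range k, W j ω ^ 2) := by
  rw [expMart, Complex.exp_add, norm_mul, Complex.norm_exp_ofReal_mul_I, one_mul,
    ← Complex.ofReal_exp, Complex.norm_real, Real.norm_of_nonneg (Real.exp_nonneg _)]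

theorem expMart_succ (s a : ℝ) (W ξ : ℕ → Ω → ℝ) (k : ℕ) (ω : Ω) :
    expMart s a W ξ (k + 1) ω = expMart s a W ξ k ω * Complex.exp ((a * W k ω ^ 2 : ℝ)) *
      Complex.exp (((s * W k ω * ξ k ω : ℝ) : ℂ) * Complex.I) := by
  rw [expMart, expMart, ← Complex.exp_add, ← Complex.exp_add, Finset.sum_range_succ,
    Finset.sum_range_succ]
  congr 1
  push_cast
  ring

end ExponentialProcess

/-! ### Central limit theorem for martingale transforms -/

section MartingaleCLT

variable {Ω : Type*} [mΩ : MeasurableSpace Ω] {μ : Measure Ω}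
  {F : Filtration ℕ mΩ} {ξ : ℕ → Ω → ℝ}

/-- A sum of terms known before time `n` is known before time `n`. -/
theorem measurable_sum_range_of_succ {f : ℕ → Ω → ℝ} (hf : ∀ k, Measurable[F (k + 1)] (f k))
    (n : ℕ) : Measurable[F n] (fun ω => ∑ k ∈ Finset.range n, f k ω) := by
  refine Finset.measurable_fun_sum _ fun k hk => ?_
  exact (hf k).mono (F.mono (Finset.mem_range.1 hk)) le_rfl

theorem measurable_expMart (h : IsInnovation F ξ μ) {W : ℕ → Ω → ℝ}
    (hW : ∀ k, Measurable[F k] (W k)) (s a : ℝ) (k : ℕ) :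
    Measurable[F k] (expMart s a W ξ k) := by
  have h1 : Measurable[F k] (fun ω => ∑ j ∈ Finset.range k, W j ω * ξ j ω) :=
    measurable_sum_range_of_succ
      (fun j => ((hW j).mono (F.mono j.le_succ) le_rfl).mul (h.measurable_succ j)) k
  have h2 : Measurable[F k] (fun ω => ∑ j ∈ Finset.range k, W j ω ^ 2) :=
    measurable_sum_range_of_succ
      (fun j => ((hW j).mono (F.mono j.le_succ) le_rfl).pow_const 2) k
  exact Complex.measurable_exp.comp
    (((Complex.measurable_ofReal.comp (h1.const_mul s)).mul_const _).add
      (Complex.measurable_ofReal.comp (h2.const_mul a)))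

variable [IsProbabilityMeasure μ]

/-- One step of the exponential process, with `a = s² Var ξ / 2`: its expectation moves only by the
error made on replacing the characteristic function of `ξ` by the Gaussian one. -/
theorem norm_integral_expMart_succ_sub_le (h : IsInnovation F ξ μ) {W U : ℕ → Ω → ℝ}
    (hW : ∀ k, Measurable[F k] (W k)) (hWU : ∀ k ω, |W k ω| ≤ |U k ω|)
    (hint : ∀ k, Integrable (fun ω => U k ω ^ 4) μ) {C : ℝ} (hC : ∀ k, ∫ ω, U k ω ^ 4 ∂μ ≤ C)
    {K v s a B : ℝ} (hK0 : 0 ≤ K) (ha : a = v * s ^ 2 / 2)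
    (hK : ∀ u : ℝ, ‖charFun (μ.map (ξ 0)) u - Complex.exp (-((v * u ^ 2 / 2 : ℝ) : ℂ))‖ ≤
      K * (|u| ^ 3 + u ^ 4))
    (hB : ∀ k ω, a * ∑ j ∈ Finset.range k, W j ω ^ 2 ≤ B) (k : ℕ) :
    ‖∫ ω, expMart s a W ξ (k + 1) ω ∂μ - ∫ ω, expMart s a W ξ k ω ∂μ‖ ≤
      Real.exp B * K * (|s| ^ 3 + s ^ 4) * (1 + C) := by
  set A : Ω → ℂ := fun ω => expMart s a W ξ k ω * Complex.exp ((a * W k ω ^ 2 : ℝ)) with hA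
  have hAm : Measurable[F k] A :=
    (measurable_expMart h hW s a k).mul
      (Complex.measurable_exp.comp
        (Complex.measurable_ofReal.comp (((hW k).pow_const 2).const_mul a)))
  have hAB : ∀ ω, ‖A ω‖ ≤ Real.exp B := fun ω => by
    have e : ‖A ω‖ = ‖expMart s a W ξ (k + 1) ω‖ := by
      rw [expMart_succ, norm_mul _ (Complex.exp (_ * Complex.I)),
        Complex.norm_exp_ofReal_mul_I, mul_one]
    rw [e, norm_expMart]
    exact Real.exp_le_exp.2 (hB _ _)
  have hmeas : Measurable A := hAm.mono (F.le k) le_rfl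
  have hWm : Measurable (W k) := (hW k).mono (F.le k) le_rfl
  have hlaw : μ.map (ξ k) = μ.map (ξ 0) := (h.identDistrib k).map_eq
  have : IsProbabilityMeasure (μ.map (ξ 0)) :=
    Measure.isProbabilityMeasure_map (h.measurable 0).aemeasurable
  -- The innovation `ξ k` is integrated out first, the past being frozen.
  have e1 : ∫ ω, expMart s a W ξ (k + 1) ω ∂μ =
      ∫ ω, A ω * charFun (μ.map (ξ 0)) (s * W k ω) ∂μ := by
    simp_rw [expMart_succ]
    rw [← hlaw]
    exact @integral_mul_exp_eq_integral_mul_charFun Ω mΩ μ Ω (F k) _ id (ξ k)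
      (measurable_id'' (F.le k)) (h.measurable k)
      (@IsInnovation.indepFun Ω mΩ μ F ξ h Ω (F k) k id (@measurable_id Ω (F k))) A
      (fun ω => s * W k ω) (Real.exp B) hAm ((hW k).const_mul s) hAB
  have e2 : ∀ ω, expMart s a W ξ k ω =
      A ω * Complex.exp (-((v * (s * W k ω) ^ 2 / 2 : ℝ) : ℂ)) := fun ω => by
    rw [hA, mul_assoc, ← Complex.exp_add]
    have : ((a * W k ω ^ 2 : ℝ) : ℂ) + -((v * (s * W k ω) ^ 2 / 2 : ℝ) : ℂ) = 0 := by
      rw [ha]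
      push_cast
      ring
    rw [this, Complex.exp_zero, mul_one]
  have i1 : Integrable (fun ω => A ω * charFun (μ.map (ξ 0)) (s * W k ω)) μ := by
    refine Integrable.of_bound (hmeas.mul
      (measurable_charFun.comp (hWm.const_mul s))).aestronglyMeasurable (Real.exp B * 1)
      (ae_of_all _ fun ω => ?_)
    rw [norm_mul]
    exact mul_le_mul (hAB ω) (norm_charFun_le_one _) (norm_nonneg _) (Real.exp_nonneg _)
  have i2 : Integrable (expMart s a W ξ k) μ := by
    refine Integrable.of_bound ((measurable_expMart h hW s a k).mono
      (F.le k) le_rfl).aestronglyMeasurable (Real.exp B) (ae_of_all _ fun ω => ?_)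
    rw [norm_expMart]
    exact Real.exp_le_exp.2 (hB _ _)
  rw [e1, ← integral_sub i1 i2]
  have hbound : ∀ ω, ‖A ω * charFun (μ.map (ξ 0)) (s * W k ω) - expMart s a W ξ k ω‖ ≤
      Real.exp B * K * (|s| ^ 3 + s ^ 4) * (1 + U k ω ^ 4) := fun ω => by
    rw [e2, ← mul_sub, norm_mul]
    have w4 : W k ω ^ 4 ≤ U k ω ^ 4 := by
      have := pow_le_pow_left₀ (abs_nonneg _) (hWU k ω) 4
      rwa [Even.pow_abs (by decide), Even.pow_abs (by decide)] at this
    have w3 : |W k ω| ^ 3 ≤ 1 + |W k ω| ^ 4 := by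
      rcases le_or_gt |W k ω| 1 with h1 | h1
      · have := pow_le_one₀ (n := 3) (abs_nonneg _) h1
        have := pow_nonneg (abs_nonneg (W k ω)) 4
        linarith
      · have := pow_le_pow_right₀ h1.le (show 3 ≤ 4 by norm_num)
        linarith
    rw [Even.pow_abs (n := 4) (by decide)] at w3
    calc ‖A ω‖ * ‖charFun (μ.map (ξ 0)) (s * W k ω) -
            Complex.exp (-((v * (s * W k ω) ^ 2 / 2 : ℝ) : ℂ))‖
        ≤ Real.exp B * (K * (|s * W k ω| ^ 3 + (s * W k ω) ^ 4)) :=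
          mul_le_mul (hAB ω) (hK _) (norm_nonneg _) (Real.exp_nonneg _)
      _ = Real.exp B * K * (|s| ^ 3 * |W k ω| ^ 3 + s ^ 4 * W k ω ^ 4) := by
          rw [abs_mul, mul_pow, mul_pow, mul_assoc]
      _ ≤ Real.exp B * K * (|s| ^ 3 * (1 + U k ω ^ 4) + s ^ 4 * (1 + U k ω ^ 4)) := by
          gcongr
          · linarith
          · linarith
      _ = _ := by ring
  refine (norm_integral_le_integral_norm _).trans ?_
  have i3 : Integrable (fun ω => Real.exp B * K * (|s| ^ 3 + s ^ 4) * (1 + U k ω ^ 4)) μ :=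
    ((integrable_const _).add (hint k)).const_mul _
  refine (integral_mono_of_nonneg (ae_of_all _ fun ω => norm_nonneg _) i3
    (ae_of_all _ hbound)).trans ?_
  rw [integral_const_mul, integral_add (integrable_const _) (hint k)]
  simp only [integral_const, probReal_univ, smul_eq_mul, mul_one]
  have := hC k
  have : 0 ≤ s ^ 4 := by positivity
  gcongr

theorem norm_integral_expMart_sub_one_le (h : IsInnovation F ξ μ) {W U : ℕ → Ω → ℝ}
    (hW : ∀ k, Measurable[F k] (W k)) (hWU : ∀ k ω, |W k ω| ≤ |U k ω|)
    (hint : ∀ k, Integrable (fun ω => U k ω ^ 4) μ) {C : ℝ} (hC : ∀ k, ∫ ω, U k ω ^ 4 ∂μ ≤ C)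
    {K v s a B : ℝ} (hK0 : 0 ≤ K) (ha : a = v * s ^ 2 / 2)
    (hK : ∀ u : ℝ, ‖charFun (μ.map (ξ 0)) u - Complex.exp (-((v * u ^ 2 / 2 : ℝ) : ℂ))‖ ≤
      K * (|u| ^ 3 + u ^ 4))
    (hB : ∀ k ω, a * ∑ j ∈ Finset.range k, W j ω ^ 2 ≤ B) (n : ℕ) :
    ‖∫ ω, expMart s a W ξ n ω ∂μ - 1‖ ≤
      n * (Real.exp B * K * (|s| ^ 3 + s ^ 4) * (1 + C)) := by
  induction n with
  | zero => simp [expMart]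
  | succ n ih =>
    have := norm_integral_expMart_succ_sub_le h hW hWU hint hC hK0 ha hK hB n
    refine (norm_sub_le_norm_sub_add_norm_sub _ (∫ ω, expMart s a W ξ n ω ∂μ) _).trans ?_
    push_cast
    linarith

/-- **Central limit theorem for martingale transforms** of an i.i.d. sequence. If the coefficients
`U k` are predictable, bounded in `L⁴`, and their empirical second moments converge in probability
to a constant `ℓ`, then `n^{-1/2} ∑ U k ξ k` is asymptotically normal of variance `ℓ Var ξ`. -/
theorem IsInnovation.tendstoInDistribution_sum (h : IsInnovation F ξ μ) {U : ℕ → Ω → ℝ}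
    (hU : ∀ k, Measurable[F k] (U k)) (hint : ∀ k, Integrable (fun ω => U k ω ^ 4) μ)
    {C : ℝ} (hC : ∀ k, ∫ ω, U k ω ^ 4 ∂μ ≤ C) {ℓ : ℝ} (hℓ : 0 ≤ ℓ)
    (hlim : TendstoInMeasure μ (fun (n : ℕ) ω => (n : ℝ)⁻¹ * ∑ k ∈ Finset.range n, U k ω ^ 2)
      atTop (fun _ => ℓ)) :
    TendstoInDistribution
      (fun (n : ℕ) ω => (Real.sqrt n)⁻¹ * ∑ k ∈ Finset.range n, U k ω * ξ k ω)
      atTop (id : ℝ → ℝ) (fun _ => μ)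
      (gaussianReal 0 ((∫ ω, ξ 0 ω ^ 2 ∂μ) * ℓ).toNNReal) := by
  set v : ℝ := ∫ ω, ξ 0 ω ^ 2 ∂μ with hv
  have hv0 : 0 ≤ v := integral_nonneg fun _ => sq_nonneg _
  have hUm : ∀ k, Measurable (U k) := fun k => (hU k).mono (F.le k) le_rfl
  have hξm := h.measurable
  have hMm : ∀ n : ℕ, Measurable
      (fun ω => (Real.sqrt n)⁻¹ * ∑ k ∈ Finset.range n, U k ω * ξ k ω) := fun n => by fun_prop
  have hP : IsProbabilityMeasure (μ.map (ξ 0)) :=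
    Measure.isProbabilityMeasure_map (hξm 0).aemeasurable
  obtain ⟨K, hK0, hK⟩ : ∃ K, 0 ≤ K ∧ ∀ u : ℝ, ‖charFun (μ.map (ξ 0)) u -
      Complex.exp (-((v * u ^ 2 / 2 : ℝ) : ℂ))‖ ≤ K * (|u| ^ 3 + u ^ 4) := by
    have hm : MemLp id 4 (μ.map (ξ 0)) :=
      (memLp_map_measure_iff aestronglyMeasurable_id (hξm 0).aemeasurable).2 h.memLp_four
    have h0 : ∫ x, x ∂(μ.map (ξ 0)) = 0 := by
      rw [integral_map (hξm 0).aemeasurable (by fun_prop)]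
      exact h.integral_eq_zero
    have h2 : ∫ x, x ^ 2 ∂(μ.map (ξ 0)) = v := by
      rw [integral_map (hξm 0).aemeasurable (by fun_prop)]
    have := exists_norm_charFun_sub_exp_le hm h0
    rwa [h2] at this
  refine ⟨fun n => (hMm n).aemeasurable, aemeasurable_id, ?_⟩
  refine ProbabilityMeasure.tendsto_of_tendsto_charFun fun t => ?_
  simp only [ProbabilityMeasure.coe_mk, Measure.map_id, charFun_gaussianReal]
  set c : ℝ := v * t ^ 2 / 2 with hc
  have hc0 : 0 ≤ c := by positivity
  have hlimexp : Complex.exp (t * (0 : ℝ) * Complex.I - (v * ℓ).toNNReal * t ^ 2 / 2) =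
      Complex.exp (-((c * ℓ : ℝ) : ℂ)) := by
    congr 1
    have : (((v * ℓ).toNNReal : ℝ) : ℂ) = ((v * ℓ : ℝ) : ℂ) := by
      rw [Real.coe_toNNReal _ (by positivity)]
    rw [show (((v * ℓ).toNNReal : ℂ)) = (((v * ℓ).toNNReal : ℝ) : ℂ) from rfl, this, hc]
    push_cast
    ring
  rw [hlimexp]
  set S : ℕ → Ω → ℝ := fun n ω => ∑ k ∈ Finset.range n, U k ω ^ 2 with hS
  -- The truncation level `(ℓ + 1) n` is exceeded with vanishing probability.
  set W : ℕ → ℕ → Ω → ℝ := fun n k ω => truncateSq ((ℓ + 1) * n) (fun j => U j ω) k with hWdef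
  have hW : ∀ n k, Measurable[F k] (W n k) := fun n k => by
    refine Measurable.ite ?_ (hU k) measurable_const
    have : Measurable[F k] (fun ω => ∑ j ∈ Finset.range (k + 1), U j ω ^ 2) := by
      refine Finset.measurable_fun_sum _ fun j hj => ?_
      exact ((hU j).mono (F.mono (Nat.lt_succ_iff.1 (Finset.mem_range.1 hj))) le_rfl).pow_const 2
    exact measurableSet_le this measurable_const
  set s : ℕ → ℝ := fun n => t * (Real.sqrt n)⁻¹ with hs
  have hs2 : ∀ n : ℕ, c * (n : ℝ)⁻¹ = v * s n ^ 2 / 2 := fun n => by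
    rw [hs, hc, mul_pow, inv_pow, Real.sq_sqrt (Nat.cast_nonneg n)]
    ring
  have hB : ∀ (n k : ℕ) ω,
      c * (n : ℝ)⁻¹ * ∑ j ∈ Finset.range k, W n j ω ^ 2 ≤ c * (ℓ + 1) := fun n k ω => by
    rw [mul_assoc]
    refine mul_le_mul_of_nonneg_left ?_ hc0
    have h1 := sum_truncateSq_sq_le (B := (ℓ + 1) * n) (by positivity) (fun j => U j ω) k
    rcases Nat.eq_zero_or_pos n with rfl | hn
    · simp only [Nat.cast_zero, inv_zero, zero_mul]
      linarith
    · have hn' : (0 : ℝ) < n := by exact_mod_cast hn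
      rw [inv_mul_le_iff₀ hn', mul_comm]
      linarith
  set Z : ℕ → Ω → ℂ := fun n => expMart (s n) (c * (n : ℝ)⁻¹) (W n) ξ n with hZ
  have hZm : ∀ n, Measurable (Z n) := fun n =>
    (measurable_expMart h (hW n) _ _ n).mono (F.le n) le_rfl
  have hZB : ∀ n ω, ‖Z n ω‖ ≤ Real.exp (c * (ℓ + 1)) := fun n ω => by
    rw [hZ, norm_expMart]
    exact Real.exp_le_exp.2 (hB n n ω)
  have hZlim : Tendsto (fun n => ∫ ω, Z n ω ∂μ) atTop (𝓝 1) := by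
    rw [tendsto_iff_norm_sub_tendsto_zero]
    have hb : ∀ n : ℕ, ‖∫ ω, Z n ω ∂μ - 1‖ ≤
        n * (Real.exp (c * (ℓ + 1)) * K * (|s n| ^ 3 + s n ^ 4) * (1 + C)) := fun n =>
      norm_integral_expMart_sub_one_le h (hW n)
        (fun k ω => abs_truncateSq_le _ _ _) hint hC hK0 (hs2 n) hK (hB n) n
    have hr : Tendsto (fun n : ℕ => (Real.sqrt n)⁻¹) atTop (𝓝 0) :=
      tendsto_inv_atTop_zero.comp (Real.tendsto_sqrt_atTop.comp tendsto_natCast_atTop_atTop)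
    have hlim0 : Tendsto (fun n : ℕ => Real.exp (c * (ℓ + 1)) * K * (1 + C) *
        (|t| ^ 3 * (Real.sqrt n)⁻¹ + t ^ 4 * ((Real.sqrt n)⁻¹ * (Real.sqrt n)⁻¹)))
        atTop (𝓝 0) := by
      simpa using ((hr.const_mul (|t| ^ 3)).add ((hr.mul hr).const_mul (t ^ 4))).const_mul
        (Real.exp (c * (ℓ + 1)) * K * (1 + C))
    refine squeeze_zero (fun _ => norm_nonneg _) (fun n => (hb n).trans_eq ?_) hlim0
    rcases Nat.eq_zero_or_pos n with rfl | hn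
    · simp
    · have hq : 0 < Real.sqrt n := Real.sqrt_pos.2 (by exact_mod_cast hn)
      have hn2 : (n : ℝ) = Real.sqrt n ^ 2 := (Real.sq_sqrt (Nat.cast_nonneg n)).symm
      simp only [hs]
      rw [abs_mul, abs_of_pos (inv_pos.2 hq)]
      generalize Real.sqrt n = q at *
      rw [hn2]
      field_simp
  set E : ℕ → Ω → ℂ := fun n ω =>
    Complex.exp (((s n * ∑ k ∈ Finset.range n, U k ω * ξ k ω : ℝ) : ℂ) * Complex.I) with hE
  have hEm : ∀ n, Measurable (E n) := fun n => by fun_prop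
  have hE1 : ∀ n ω, ‖E n ω‖ = 1 := fun n ω => Complex.norm_exp_ofReal_mul_I _
  have hD : Tendsto (fun n => ∫ ω, (E n ω * (Real.exp (c * ℓ) : ℂ) - Z n ω) ∂μ) atTop (𝓝 0) := by
    refine tendsto_integral_zero_of_norm_le_of_tendstoInMeasure
      (B := Real.exp (c * ℓ) + Real.exp (c * (ℓ + 1)))
      (fun n => (((hEm n).mul_const _).sub (hZm n)).aestronglyMeasurable) (fun n ω => ?_) ?_
    · refine (norm_sub_le _ _).trans (add_le_add ?_ (hZB n ω))
      rw [norm_mul, hE1, one_mul, Complex.norm_real, Real.norm_of_nonneg (Real.exp_nonneg _)]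
    have hexp := tendstoInMeasure_continuousAt_comp (φ := fun x => Real.exp (c * x)) hlim
      (by fun_prop)
    rw [tendstoInMeasure_iff_dist] at hlim hexp ⊢
    intro ε hε
    have hsum := (hlim 1 one_pos).add (hexp ε hε)
    rw [add_zero] at hsum
    refine tendsto_of_tendsto_of_tendsto_of_le_of_le tendsto_const_nhds hsum
      (fun _ => zero_le) fun n => (measure_mono fun ω hω => ?_).trans (measure_union_le _ _)
    simp only [Set.mem_ofPred_eq, Set.mem_union, dist_zero_right] at hω ⊢
    by_contra! hlt
    refine absurd hω (not_le.2 ?_)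
    have hle : S n ω ≤ (ℓ + 1) * n := by
      rcases Nat.eq_zero_or_pos n with rfl | hn
      · simp [hS]
      · have hn' : (0 : ℝ) < n := by exact_mod_cast hn
        have := (abs_lt.1 hlt.1).2
        have h2 : (n : ℝ)⁻¹ * S n ω ≤ ℓ + 1 := by
          simp only [hS]
          linarith
        rw [inv_mul_le_iff₀ hn'] at h2
        linarith
    have hWU : ∀ k ∈ Finset.range n, W n k ω = U k ω := fun k hk =>
      truncateSq_eq_of_sum_le hle (Finset.mem_range.1 hk)
    have hZE : Z n ω = E n ω * (Real.exp (c * ((n : ℝ)⁻¹ * S n ω)) : ℂ) := by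
      simp only [hZ, hE, expMart]
      have q1 : ∑ k ∈ Finset.range n, W n k ω * ξ k ω = ∑ k ∈ Finset.range n, U k ω * ξ k ω :=
        Finset.sum_congr rfl fun k hk => by rw [hWU k hk]
      have q2 : ∑ k ∈ Finset.range n, W n k ω ^ 2 = S n ω :=
        Finset.sum_congr rfl fun k hk => by rw [hWU k hk]
      rw [q1, q2, Complex.exp_add, mul_assoc c, Complex.ofReal_exp]
    rw [hZE, ← mul_sub, norm_mul, hE1, one_mul, ← Complex.ofReal_sub, Complex.norm_real,
      norm_sub_rev]
    exact hlt.2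
  have hEi : ∀ n, Integrable (E n) μ := fun n =>
    Integrable.of_bound (hEm n).aestronglyMeasurable 1 (ae_of_all _ fun ω => (hE1 n ω).le)
  have hZi : ∀ n, Integrable (Z n) μ := fun n =>
    Integrable.of_bound (hZm n).aestronglyMeasurable _ (ae_of_all _ fun ω => hZB n ω)
  have hfin := (hD.add hZlim).const_mul (Complex.exp (-((c * ℓ : ℝ) : ℂ)))
  rw [zero_add, mul_one] at hfin
  refine hfin.congr fun n => ?_
  rw [integral_sub ((hEi n).mul_const _) (hZi n), sub_add_cancel, integral_mul_const,
    Complex.ofReal_exp, mul_comm, mul_assoc, ← Complex.exp_add, add_neg_cancel, Complex.exp_zero,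
    mul_one, charFun_apply_real, integral_map (hMm n).aemeasurable (by fun_prop)]
  refine integral_congr_ae (ae_of_all _ fun ω => ?_)
  simp only [hE, hs]
  push_cast
  congr 1
  ring

end MartingaleCLT

/-! ### Boundedness in `L⁴` -/

section BoundedFourthMoments

variable {Ω : Type*} [mΩ : MeasurableSpace Ω] {μ : Measure Ω}

/-- The sequence `f` is bounded in `L⁴(μ)`. -/
def BoundedL4 (f : ℕ → Ω → ℝ) (μ : Measure Ω) : Prop :=
  ∃ C, ∀ k, AEStronglyMeasurable (f k) μ ∧ Integrable (fun ω => f k ω ^ 4) μ ∧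
    ∫ ω, f k ω ^ 4 ∂μ ≤ C

theorem boundedL4_const [IsProbabilityMeasure μ] (c : ℝ) : BoundedL4 (fun _ _ => c) μ :=
  ⟨c ^ 4, fun _ => ⟨aestronglyMeasurable_const, integrable_const _, by simp⟩⟩

theorem BoundedL4.const_mul {f : ℕ → Ω → ℝ} (hf : BoundedL4 f μ) (c : ℝ) :
    BoundedL4 (fun k ω => c * f k ω) μ := by
  obtain ⟨C, hC⟩ := hf
  refine ⟨c ^ 4 * C, fun k => ?_⟩
  obtain ⟨h1, h2, h3⟩ := hC k
  simp only [mul_pow]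
  refine ⟨h1.const_mul c, h2.const_mul _, ?_⟩
  rw [integral_const_mul]
  exact mul_le_mul_of_nonneg_left h3 (by positivity)

theorem abs_mul_le_two_add_pow_four (x y : ℝ) : |x * y| ≤ 2 + (x ^ 4 + y ^ 4) := by
  rw [abs_mul]
  nlinarith [sq_nonneg (|x| - |y|), sq_abs x, sq_abs y, sq_nonneg (x ^ 2 - 1),
    sq_nonneg (y ^ 2 - 1)]

theorem BoundedL4.mul [IsProbabilityMeasure μ] {f g : ℕ → Ω → ℝ} (hf : BoundedL4 f μ)
    (hg : BoundedL4 g μ) :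
    ∃ K, ∀ k, Integrable (fun ω => f k ω * g k ω) μ ∧ ∫ ω, |f k ω * g k ω| ∂μ ≤ K := by
  obtain ⟨C, hC⟩ := hf
  obtain ⟨D, hD⟩ := hg
  refine ⟨2 + (C + D), fun k => ?_⟩
  obtain ⟨f1, f2, f3⟩ := hC k
  obtain ⟨g1, g2, g3⟩ := hD k
  have i4 : Integrable (fun ω => f k ω ^ 4 + g k ω ^ 4) μ := f2.add g2
  have i : Integrable (fun ω => 2 + (f k ω ^ 4 + g k ω ^ 4)) μ := (integrable_const _).add i4
  have hi : Integrable (fun ω => f k ω * g k ω) μ :=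
    i.mono' (f1.mul g1) (ae_of_all _ fun ω => abs_mul_le_two_add_pow_four _ _)
  refine ⟨hi, (integral_mono hi.abs i fun ω => abs_mul_le_two_add_pow_four _ _).trans ?_⟩
  rw [integral_add (integrable_const _) i4, integral_add f2 g2]
  simp only [integral_const, probReal_univ, smul_eq_mul, one_mul]
  linarith

theorem BoundedL4.integrable [IsProbabilityMeasure μ] {f : ℕ → Ω → ℝ} (hf : BoundedL4 f μ) :
    ∃ K, ∀ k, Integrable (f k) μ ∧ ∫ ω, |f k ω| ∂μ ≤ K := by
  simpa using hf.mul (boundedL4_const 1)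

end BoundedFourthMoments

/-! ### First-order autoregressions started from zero -/

section Autoregression

variable {Ω : Type*} [mΩ : MeasurableSpace Ω] {μ : Measure Ω}

/-- The first-order autoregression with coefficient `a`, input `x` and initial value `0`. -/
noncomputable def arFilter (a : ℝ) (x : ℕ → Ω → ℝ) : ℕ → Ω → ℝ
  | 0, _ => 0
  | k + 1, ω => a * arFilter a x k ω + x k ω

theorem measurable_arFilter {F : Filtration ℕ mΩ} {a : ℝ} {x : ℕ → Ω → ℝ}
    (hx : ∀ k, Measurable[F (k + 1)] (x k)) (k : ℕ) : Measurable[F k] (arFilter a x k) := by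
  induction k with
  | zero => exact measurable_const
  | succ k ih => exact ((ih.mono (F.mono k.le_succ) le_rfl).const_mul a).add (hx k)

theorem pow_four_add_le {a : ℝ} (ha : |a| < 1) (x y : ℝ) :
    (a * x + y) ^ 4 ≤ |a| * x ^ 4 + (1 - |a|) * ((1 - |a|)⁻¹ * y) ^ 4 := by
  have h1 : 0 < 1 - |a| := by linarith
  have hc := (Even.convexOn_pow (n := 4) (by decide) : ConvexOn ℝ Set.univ fun x : ℝ => x ^ 4).2
    (Set.mem_univ (SignType.sign a * x)) (Set.mem_univ ((1 - |a|)⁻¹ * y)) (abs_nonneg a) h1.le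
    (by ring)
  simp only [smul_eq_mul] at hc
  have e1 : |a| * (SignType.sign a * x) + (1 - |a|) * ((1 - |a|)⁻¹ * y) = a * x + y := by
    rw [← mul_assoc, ← mul_assoc, abs_mul_sign, mul_inv_cancel₀ h1.ne', one_mul]
  have e2 : |a| * (SignType.sign a * x) ^ 4 ≤ |a| * x ^ 4 := by
    refine mul_le_mul_of_nonneg_left ?_ (abs_nonneg a)
    rcases lt_trichotomy a 0 with h | h | h
    · simp [sign_neg h, Even.neg_pow (show Even 4 by decide)]
    · simp [h]
      positivity
    · simp [sign_pos h]
  rw [e1] at hc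
  linarith

/-- A stable autoregression preserves boundedness in `L⁴`. -/
theorem BoundedL4.arFilter {a : ℝ} (ha : |a| < 1) {x : ℕ → Ω → ℝ}
    (hx : BoundedL4 x μ) : BoundedL4 (arFilter a x) μ := by
  obtain ⟨C, hC⟩ := hx
  have h1 : 0 < 1 - |a| := by linarith
  have hC0 : 0 ≤ C := (integral_nonneg fun ω => by positivity).trans (hC 0).2.2
  -- `D` is the fixed point of the recursive bound given by convexity of the fourth power.
  set D : ℝ := (1 - |a|)⁻¹ ^ 4 * C with hD
  refine ⟨D, fun k => ?_⟩
  induction k with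
  | zero =>
    refine ⟨aestronglyMeasurable_const, ?_, ?_⟩
    · simp [_root_.arFilter]
    · simp only [_root_.arFilter]
      norm_num
      positivity
  | succ k ih =>
    obtain ⟨y1, y2, y3⟩ := ih
    obtain ⟨x1, x2, x3⟩ := hC k
    have i : Integrable (fun ω => |a| * _root_.arFilter a x k ω ^ 4 +
        (1 - |a|) * ((1 - |a|)⁻¹ ^ 4 * x k ω ^ 4)) μ :=
      (y2.const_mul _).add ((x2.const_mul _).const_mul _)
    have hle : ∀ ω, _root_.arFilter a x (k + 1) ω ^ 4 ≤ |a| * _root_.arFilter a x k ω ^ 4 +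
        (1 - |a|) * ((1 - |a|)⁻¹ ^ 4 * x k ω ^ 4) := fun ω => by
      rw [← mul_pow]
      exact pow_four_add_le ha _ _
    have m : AEStronglyMeasurable (_root_.arFilter a x (k + 1)) μ := (y1.const_mul a).add x1
    have i' : Integrable (fun ω => _root_.arFilter a x (k + 1) ω ^ 4) μ := by
      refine i.mono' (m.pow 4) (ae_of_all _ fun ω => ?_)
      rw [Real.norm_of_nonneg (by positivity)]
      exact hle ω
    refine ⟨m, i', (integral_mono i' i hle).trans ?_⟩
    rw [integral_add (y2.const_mul _) ((x2.const_mul _).const_mul _), integral_const_mul,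
      integral_const_mul, integral_const_mul]
    calc _ ≤ |a| * D + (1 - |a|) * ((1 - |a|)⁻¹ ^ 4 * C) := by gcongr
      _ = D := by
        rw [hD]
        ring

end Autoregression

/-! ### Laws of large numbers -/

section LawOfLargeNumbers

variable {Ω : Type*} [mΩ : MeasurableSpace Ω] {μ : Measure Ω}
  {F : Filtration ℕ mΩ} {ξ : ℕ → Ω → ℝ}

theorem IsInnovation.boundedL4 (h : IsInnovation F ξ μ) : BoundedL4 ξ μ := by
  have i0 : Integrable (fun ω => ξ 0 ω ^ 4) μ := by
    have := h.memLp_four.integrable_norm_pow (p := 4) (by norm_num)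
    refine this.congr (ae_of_all _ fun ω => ?_)
    simp only [Real.norm_eq_abs]
    exact Even.pow_abs (by decide) _
  refine ⟨∫ ω, ξ 0 ω ^ 4 ∂μ, fun k => ?_⟩
  have hd : IdentDistrib (fun ω => ξ k ω ^ 4) (fun ω => ξ 0 ω ^ 4) μ μ :=
    (h.identDistrib k).comp (u := fun x : ℝ => x ^ 4) (by fun_prop)
  exact ⟨(h.measurable k).aestronglyMeasurable, hd.integrable_iff.2 i0, hd.integral_eq.le⟩

variable [IsProbabilityMeasure μ]

/-- The terms of a martingale transform are orthogonal, so its second moment grows at most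
linearly. -/
theorem IsInnovation.integral_sq_sum_le (h : IsInnovation F ξ μ) {U : ℕ → Ω → ℝ}
    (hU : ∀ k, Measurable[F k] (U k)) (hU4 : BoundedL4 U μ) :
    ∃ K, ∀ n, MemLp (fun ω => ∑ k ∈ Finset.range n, U k ω * ξ k ω) 2 μ ∧
      ∫ ω, (∑ k ∈ Finset.range n, U k ω * ξ k ω) ^ 2 ∂μ ≤ n * K := by
  obtain ⟨C, hC⟩ := hU4.mul hU4
  obtain ⟨D, hD⟩ := h.boundedL4.mul h.boundedL4
  have hUm : ∀ k, Measurable (U k) := fun k => (hU k).mono (F.le k) le_rfl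
  have hUsq : ∀ k, MemLp (U k) 2 μ := fun k =>
    (memLp_two_iff_integrable_sq (hUm k).aestronglyMeasurable).2
      ((hC k).1.congr (ae_of_all _ fun ω => (sq _).symm))
  have hterm : ∀ k, Integrable (fun ω => U k ω ^ 2 * ξ k ω ^ 2) μ ∧
      ∫ ω, U k ω ^ 2 * ξ k ω ^ 2 ∂μ ≤ C * D := fun k => by
    have hind : IndepFun (fun ω => U k ω ^ 2) (fun ω => ξ k ω ^ 2) μ :=
      (h.indepFun (hU k)).comp (φ := fun x : ℝ => x ^ 2) (ψ := fun x : ℝ => x ^ 2)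
        (by fun_prop) (by fun_prop)
    have i1 : Integrable (fun ω => U k ω ^ 2) μ := (hUsq k).integrable_sq
    have i2 : Integrable (fun ω => ξ k ω ^ 2) μ :=
      (hD k).1.congr (ae_of_all _ fun ω => (sq _).symm)
    refine ⟨hind.integrable_mul i1 i2, ?_⟩
    rw [hind.integral_fun_mul_eq_mul_integral i1.aestronglyMeasurable i2.aestronglyMeasurable]
    have b1 : ∫ ω, U k ω ^ 2 ∂μ ≤ C := by
      refine le_trans (le_of_eq ?_) (hC k).2
      exact integral_congr_ae (ae_of_all _ fun ω => by simp [sq])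
    have b2 : ∫ ω, ξ k ω ^ 2 ∂μ ≤ D := by
      refine le_trans (le_of_eq ?_) (hD k).2
      exact integral_congr_ae (ae_of_all _ fun ω => by simp [sq])
    exact mul_le_mul b1 b2 (integral_nonneg fun _ => sq_nonneg _)
      ((integral_nonneg fun _ => sq_nonneg _).trans b1)
  have hL2 : ∀ k, MemLp (fun ω => U k ω * ξ k ω) 2 μ := fun k => by
    refine (memLp_two_iff_integrable_sq
      ((hUm k).mul (h.measurable k)).aestronglyMeasurable).2 ?_
    exact (hterm k).1.congr (ae_of_all _ fun ω => (mul_pow _ _ 2).symm)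
  have hM : ∀ n, MemLp (fun ω => ∑ k ∈ Finset.range n, U k ω * ξ k ω) 2 μ := fun n =>
    memLp_finsetSum _ fun k _ => hL2 k
  refine ⟨C * D, fun n => ⟨hM n, ?_⟩⟩
  induction n with
  | zero => simp
  | succ n ih =>
    have hMn : Measurable[F n] (fun ω => ∑ k ∈ Finset.range n, U k ω * ξ k ω) :=
      measurable_sum_range_of_succ
        (fun j => ((hU j).mono (F.mono j.le_succ) le_rfl).mul (h.measurable_succ j)) n
    have hcross : ∫ ω, (∑ k ∈ Finset.range n, U k ω * ξ k ω) * (U n ω * ξ n ω) ∂μ = 0 := by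
      have hp : Measurable[F n] (fun ω => (∑ k ∈ Finset.range n, U k ω * ξ k ω) * U n ω) :=
        hMn.mul (hU n)
      simp_rw [← mul_assoc]
      rw [(h.indepFun hp).integral_fun_mul_eq_mul_integral
        (hp.mono (F.le n) le_rfl).aestronglyMeasurable (h.measurable n).aestronglyMeasurable,
        (h.identDistrib n).integral_eq, h.integral_eq_zero, mul_zero]
    have ic : Integrable
        (fun ω => (∑ k ∈ Finset.range n, U k ω * ξ k ω) * (U n ω * ξ n ω)) μ :=
      (hM n).integrable_mul (hL2 n)
    have e : ∀ ω, (∑ k ∈ Finset.range (n + 1), U k ω * ξ k ω) ^ 2 =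
        ((∑ k ∈ Finset.range n, U k ω * ξ k ω) ^ 2 +
        2 * ((∑ k ∈ Finset.range n, U k ω * ξ k ω) * (U n ω * ξ n ω))) +
          U n ω ^ 2 * ξ n ω ^ 2 := fun ω => by
      rw [Finset.sum_range_succ]
      ring
    simp_rw [e]
    have i2 : Integrable (fun ω => (∑ k ∈ Finset.range n, U k ω * ξ k ω) ^ 2 +
        2 * ((∑ k ∈ Finset.range n, U k ω * ξ k ω) * (U n ω * ξ n ω))) μ :=
      (hM n).integrable_sq.add (ic.const_mul 2)
    rw [integral_add i2 (hterm n).1,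
      integral_add (hM n).integrable_sq (ic.const_mul 2), integral_const_mul, hcross]
    push_cast
    linarith [(hterm n).2]

theorem tendsto_inv_sqrt_natCast_atTop : Tendsto (fun n : ℕ => (Real.sqrt n)⁻¹) atTop (𝓝 0) :=
  tendsto_inv_atTop_zero.comp (Real.tendsto_sqrt_atTop.comp tendsto_natCast_atTop_atTop)

/-- Weak law of large numbers for martingale transforms. -/
theorem IsInnovation.tendstoInMeasure_average (h : IsInnovation F ξ μ) {U : ℕ → Ω → ℝ}
    (hU : ∀ k, Measurable[F k] (U k)) (hU4 : BoundedL4 U μ) :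
    TendstoInMeasure μ (fun (n : ℕ) ω => (n : ℝ)⁻¹ * ∑ k ∈ Finset.range n, U k ω * ξ k ω) atTop
      (fun _ => 0) := by
  obtain ⟨K, hK⟩ := h.integral_sq_sum_le hU hU4
  have hK0 : 0 ≤ K := by
    have := (integral_nonneg fun ω => sq_nonneg _).trans (hK 1).2
    simpa using this
  set M : ℕ → Ω → ℝ := fun n ω => ∑ k ∈ Finset.range n, U k ω * ξ k ω with hM
  have hi : ∀ n, Integrable (M n) μ := fun n => (hK n).1.integrable (by norm_num)
  have hb : ∀ n : ℕ, ∫ ω, |(Real.sqrt n)⁻¹ * M n ω| ∂μ ≤ 1 + K := fun n => by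
    have i2 : Integrable (fun ω => 1 + (n : ℝ)⁻¹ * M n ω ^ 2) μ :=
      (integrable_const _).add ((hK n).1.integrable_sq.const_mul _)
    have hle : ∀ ω, |(Real.sqrt n)⁻¹ * M n ω| ≤ 1 + (n : ℝ)⁻¹ * M n ω ^ 2 := fun ω => by
      have : (n : ℝ)⁻¹ * M n ω ^ 2 = |(Real.sqrt n)⁻¹ * M n ω| ^ 2 := by
        rw [sq_abs, mul_pow, inv_pow, Real.sq_sqrt (Nat.cast_nonneg n)]
      rw [this]
      nlinarith [sq_nonneg (|(Real.sqrt n)⁻¹ * M n ω| - 1)]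
    refine (integral_mono ((hi n).const_mul _).abs i2 hle).trans ?_
    rw [integral_add (integrable_const _) ((hK n).1.integrable_sq.const_mul _),
      integral_const_mul]
    simp only [integral_const, probReal_univ, smul_eq_mul, one_mul]
    have : (n : ℝ)⁻¹ * ∫ ω, M n ω ^ 2 ∂μ ≤ K := by
      rcases Nat.eq_zero_or_pos n with rfl | hn
      · simpa using hK0
      · rw [inv_mul_le_iff₀ (by exact_mod_cast hn)]
        exact (hK n).2
    linarith
  have := tendstoInMeasure_mul_of_integral_abs_le tendsto_inv_sqrt_natCast_atTop
    (fun n => (hi n).const_mul (Real.sqrt n)⁻¹) hb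
  refine this.congr_left fun n => ae_of_all _ fun ω => ?_
  simp only
  rw [← mul_assoc, ← mul_inv, Real.mul_self_sqrt (Nat.cast_nonneg n)]

theorem IsInnovation.tendstoInMeasure_average_sq (h : IsInnovation F ξ μ) :
    TendstoInMeasure μ (fun (n : ℕ) ω => (n : ℝ)⁻¹ * ∑ k ∈ Finset.range n, ξ k ω ^ 2) atTop
      (fun _ => ∫ ω, ξ 0 ω ^ 2 ∂μ) := by
  have hξm := h.measurable
  refine tendstoInMeasure_of_tendsto_ae
    (fun n => Measurable.aestronglyMeasurable (by fun_prop)) ?_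
  obtain ⟨D, hD⟩ := h.boundedL4.mul h.boundedL4
  have hind : ∀ i j, i < j → IndepFun (ξ i) (ξ j) μ := fun i j hij =>
    h.indepFun ((h.measurable_succ i).mono (F.mono hij) le_rfl)
  have hlln := strong_law_ae_real (fun k ω => ξ k ω ^ 2)
    ((hD 0).1.congr (ae_of_all _ fun ω => (sq _).symm))
    (fun i j hij => by
      have : IndepFun (ξ i) (ξ j) μ := by
        rcases lt_or_gt_of_ne hij with h' | h'
        · exact hind i j h'
        · exact (hind j i h').symm
      exact this.comp (φ := fun x : ℝ => x ^ 2) (ψ := fun x : ℝ => x ^ 2)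
        (by fun_prop) (by fun_prop))
    (fun i => (h.identDistrib i).comp (u := fun x : ℝ => x ^ 2) (by fun_prop))
  filter_upwards [hlln] with ω hω
  refine hω.congr fun n => ?_
  rw [div_eq_inv_mul]

/-- The empirical second moment of the doubly filtered noise converges in probability. Squaring
the two recursions expresses `∑ Y²` through `∑ ξ²`, the transforms `∑ e ξ` and `∑ Y ξ`, and
boundary terms bounded in `L¹`. -/
theorem IsInnovation.tendstoInMeasure_average_arFilter_sq (h : IsInnovation F ξ μ) {θ ρ : ℝ}
    (hθ : |θ| < 1) (hρ : |ρ| < 1) {e Y : ℕ → Ω → ℝ} (he : e = arFilter ρ ξ)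
    (hY : Y = arFilter θ fun k => e (k + 1)) :
    TendstoInMeasure μ (fun (n : ℕ) ω => (n : ℝ)⁻¹ * ∑ k ∈ Finset.range n, Y k ω ^ 2) atTop
      (fun _ => (1 + θ * ρ) / ((1 - θ ^ 2) * (1 - θ * ρ) * (1 - ρ ^ 2)) *
        ∫ ω, ξ 0 ω ^ 2 ∂μ) := by
  have hem : ∀ k, Measurable[F k] (e k) := by
    rw [he]
    exact measurable_arFilter h.measurable_succ
  have hYm : ∀ k, Measurable[F k] (Y k) := by
    rw [hY]
    exact measurable_arFilter fun k => hem (k + 1)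
  have he4 : BoundedL4 e μ := he ▸ h.boundedL4.arFilter hρ
  have he4' : BoundedL4 (fun k => e (k + 1)) μ := by
    obtain ⟨C, hC⟩ := he4
    exact ⟨C, fun k => hC (k + 1)⟩
  have hY4 : BoundedL4 Y μ := hY ▸ he4'.arFilter hθ
  have e0 : ∀ ω, e 0 ω = 0 := fun ω => by rw [he]; rfl
  have eS : ∀ k ω, e (k + 1) ω = ρ * e k ω + ξ k ω := fun k ω => by rw [he]; rfl
  have Y0 : ∀ ω, Y 0 ω = 0 := fun ω => by rw [hY]; rfl
  have YS : ∀ k ω, Y (k + 1) ω = θ * Y k ω + e (k + 1) ω := fun k ω => by rw [hY]; rfl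
  have hinv : Tendsto (fun n : ℕ => (n : ℝ)⁻¹) atTop (𝓝 0) := tendsto_inv_atTop_nhds_zero_nat
  have boundary : ∀ {f g : ℕ → Ω → ℝ}, BoundedL4 f μ → BoundedL4 g μ →
      TendstoInMeasure μ (fun (n : ℕ) ω => (n : ℝ)⁻¹ * (f n ω * g n ω)) atTop (fun _ => 0) :=
    fun hf hg => by
      obtain ⟨K, hK⟩ := hf.mul hg
      exact tendstoInMeasure_mul_of_integral_abs_le hinv (fun n => (hK n).1) fun n => (hK n).2
  have hee := boundary he4 he4
  have hYe := boundary hY4 he4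
  have hYY := boundary hY4 hY4
  have hN := h.tendstoInMeasure_average hem he4
  have hM := h.tendstoInMeasure_average hYm hY4
  have hV := h.tendstoInMeasure_average_sq
  have hθ2 : 1 - θ ^ 2 ≠ 0 := by
    have := (sq_lt_one_iff_abs_lt_one θ).2 hθ
    linarith
  have hρ2 : 1 - ρ ^ 2 ≠ 0 := by
    have := (sq_lt_one_iff_abs_lt_one ρ).2 hρ
    linarith
  have hθρ : 1 - θ * ρ ≠ 0 := by
    have h3 : |θ * ρ| < 1 := by
      rw [abs_mul]
      nlinarith [abs_nonneg θ, abs_nonneg ρ]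
    linarith [(abs_lt.1 h3).2]
  set v : ℝ := ∫ ω, ξ 0 ω ^ 2 ∂μ
  have idD : ∀ n ω, (1 - ρ ^ 2) * ∑ k ∈ Finset.range n, e k ω ^ 2 =
      2 * ρ * ∑ k ∈ Finset.range n, e k ω * ξ k ω + ∑ k ∈ Finset.range n, ξ k ω ^ 2
        - e n ω * e n ω := fun n ω => by
    induction n with
    | zero => simp [e0]
    | succ n ih =>
      simp only [Finset.sum_range_succ, eS]
      linear_combination ih
  have idB : ∀ n ω, (1 - θ * ρ) * ∑ k ∈ Finset.range n, Y k ω * e k ω =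
      θ * ∑ k ∈ Finset.range n, Y k ω * ξ k ω + ∑ k ∈ Finset.range n, e k ω ^ 2
        + e n ω * e n ω - Y n ω * e n ω := fun n ω => by
    induction n with
    | zero => simp [e0]
    | succ n ih =>
      simp only [Finset.sum_range_succ, YS, eS]
      linear_combination ih
  have idA : ∀ n ω, (1 - θ ^ 2) * ∑ k ∈ Finset.range n, Y k ω ^ 2 =
      2 * θ * ρ * ∑ k ∈ Finset.range n, Y k ω * e k ω
        + 2 * θ * ∑ k ∈ Finset.range n, Y k ω * ξ k ω + ∑ k ∈ Finset.range n, e k ω ^ 2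
        + e n ω * e n ω - Y n ω * Y n ω := fun n ω => by
    induction n with
    | zero => simp [e0, Y0]
    | succ n ih =>
      simp only [Finset.sum_range_succ, YS, eS]
      linear_combination ih
  have hD := tendstoInMeasure_const_mul (tendstoInMeasure_add_const (tendstoInMeasure_add_const
    (tendstoInMeasure_const_mul hN (2 * ρ)) hV) (tendstoInMeasure_const_mul hee (-1)))
    (1 - ρ ^ 2)⁻¹
  replace hD : TendstoInMeasure μ
      (fun (n : ℕ) ω => (n : ℝ)⁻¹ * ∑ k ∈ Finset.range n, e k ω ^ 2) atTop
      (fun _ => (1 - ρ ^ 2)⁻¹ * (2 * ρ * 0 + v + -1 * 0)) := by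
    refine hD.congr_left fun n => ae_of_all _ fun ω => ?_
    simp only
    rw [inv_mul_eq_iff_eq_mul₀ hρ2]
    linear_combination -(n : ℝ)⁻¹ * idD n ω
  have hB := tendstoInMeasure_const_mul (tendstoInMeasure_add_const (tendstoInMeasure_add_const
    (tendstoInMeasure_add_const (tendstoInMeasure_const_mul hM θ) hD) hee)
    (tendstoInMeasure_const_mul hYe (-1))) (1 - θ * ρ)⁻¹
  replace hB : TendstoInMeasure μ
      (fun (n : ℕ) ω => (n : ℝ)⁻¹ * ∑ k ∈ Finset.range n, Y k ω * e k ω) atTop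
      (fun _ => (1 - θ * ρ)⁻¹ *
        (θ * 0 + (1 - ρ ^ 2)⁻¹ * (2 * ρ * 0 + v + -1 * 0) + 0 + -1 * 0)) := by
    refine hB.congr_left fun n => ae_of_all _ fun ω => ?_
    simp only
    rw [inv_mul_eq_iff_eq_mul₀ hθρ]
    linear_combination -(n : ℝ)⁻¹ * idB n ω
  have hA := tendstoInMeasure_const_mul (tendstoInMeasure_add_const (tendstoInMeasure_add_const
    (tendstoInMeasure_add_const (tendstoInMeasure_add_const
      (tendstoInMeasure_const_mul hB (2 * θ * ρ)) (tendstoInMeasure_const_mul hM (2 * θ))) hD) hee)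
    (tendstoInMeasure_const_mul hYY (-1))) (1 - θ ^ 2)⁻¹
  refine TendstoInMeasure.congr (fun n => ae_of_all _ fun ω => ?_)
    (ae_of_all _ fun ω => ?_) hA
  · simp only
    rw [inv_mul_eq_iff_eq_mul₀ hθ2]
    linear_combination -(n : ℝ)⁻¹ * idA n ω
  · simp only
    field_simp
    ring

end LawOfLargeNumbers

/-! ### The filtration of the strict past -/

section Past

variable {Ω : Type*} [mΩ : MeasurableSpace Ω] {μ : Measure Ω}

/-- The filtration of the strict past of `ξ`: at time `k` it is generated by `ξ 0, …, ξ (k - 1)`.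
Mathlib's `Filtration.natural` includes the present value as well. -/
def pastFiltration (ξ : ℕ → Ω → ℝ) (hξ : ∀ k, Measurable (ξ k)) : Filtration ℕ mΩ where
  seq k := ⨆ j ∈ Set.Iio k, MeasurableSpace.comap (ξ j) inferInstance
  mono' _ _ hij := biSup_mono fun _ hk => lt_of_lt_of_le hk hij
  le' _ := iSup₂_le fun j _ => (hξ j).comap_le

theorem isInnovation_pastFiltration {ξ : ℕ → Ω → ℝ} (hξ : ∀ k, Measurable (ξ k))
    (hind : iIndepFun ξ μ) (hid : ∀ k, IdentDistrib (ξ k) (ξ 0) μ μ) (h4 : MemLp (ξ 0) 4 μ)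
    (h0 : ∫ ω, ξ 0 ω ∂μ = 0) : IsInnovation (pastFiltration ξ hξ) ξ μ where
  measurable_succ k := by
    refine measurable_iff_comap_le.2 ?_
    exact le_biSup (fun j => MeasurableSpace.comap (ξ j) inferInstance) (Nat.lt_succ_self k)
  indep k := by
    have := indep_iSup_of_disjoint (fun j => (hξ j).comap_le) ((iIndepFun_iff_iIndep _ _ _).1 hind)
      (S := Set.Iio k) (T := {k}) (by simp)
    rwa [iSup_singleton] at this
  identDistrib := hid
  memLp_four := h4
  integral_eq_zero := h0

end Past

/-! ### Decay of the initial values -/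

section InitialValues

theorem exists_abs_le_mul_pow {θ ρ r : ℝ} (hθ : |θ| < r) (hρ : |ρ| ≤ r) (hr : r ≤ 1)
    {δ η : ℕ → ℝ} (hη : ∀ n, η (n + 1) = ρ * η n) (hδ : ∀ n, δ (n + 1) = θ * δ n + η (n + 1)) :
    ∃ Z, ∀ k, |δ k| ≤ Z * r ^ k ∧ |η k| ≤ Z * r ^ k := by
  have hr0 : 0 ≤ r := (abs_nonneg θ).trans hθ.le
  have hg : 0 < r - |θ| := by linarith
  have hηb : ∀ k, |η k| ≤ |η 0| * r ^ k := fun k => by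
    induction k with
    | zero => simp
    | succ k ih =>
      rw [hη, abs_mul, pow_succ]
      calc |ρ| * |η k| ≤ r * (|η 0| * r ^ k) := by gcongr
        _ = _ := by ring
  have hinv : 0 < (r - |θ|)⁻¹ := inv_pos.2 hg
  set Z : ℝ := |δ 0| + |η 0| * (1 + (r - |θ|)⁻¹) with hZ
  have hZη : |η 0| ≤ Z := by
    have := mul_nonneg (abs_nonneg (η 0)) hinv.le
    have := abs_nonneg (δ 0)
    rw [hZ]
    linarith
  have hZδ : |δ 0| ≤ Z := le_add_of_nonneg_right (by positivity)
  have hZg : |η 0| ≤ Z * (r - |θ|) := by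
    have e : Z * (r - |θ|) = (|δ 0| + |η 0|) * (r - |θ|) + |η 0| := by
      rw [hZ]
      field_simp
      ring
    rw [e]
    exact le_add_of_nonneg_left (by positivity)
  have hδb : ∀ k, |δ k| ≤ Z * r ^ k := fun k => by
    induction k with
    | zero => simpa using hZδ
    | succ k ih =>
      have hp : 0 ≤ r ^ k := pow_nonneg hr0 k
      rw [hδ]
      calc |θ * δ k + η (k + 1)| ≤ |θ| * |δ k| + |η (k + 1)| := by
            rw [← abs_mul]
            exact abs_add_le _ _
        _ ≤ |θ| * (Z * r ^ k) + |η 0| * r ^ (k + 1) :=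
            add_le_add (mul_le_mul_of_nonneg_left ih (abs_nonneg _)) (hηb _)
        _ ≤ |θ| * (Z * r ^ k) + Z * (r - |θ|) * r ^ k := by
            refine add_le_add le_rfl ?_
            rw [pow_succ]
            calc |η 0| * (r ^ k * r) ≤ |η 0| * (r ^ k * 1) := by gcongr
              _ = |η 0| * r ^ k := by rw [mul_one]
              _ ≤ _ := by gcongr
        _ = Z * r ^ (k + 1) := by ring
  exact ⟨Z, fun k => ⟨hδb k, (hηb k).trans (by gcongr)⟩⟩

theorem summable_mul_of_abs_le {r Z : ℝ} {δ u : ℕ → ℝ} (hδ : ∀ k, |δ k| ≤ Z * r ^ k)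
    (hu : Summable fun k => r ^ k * |u k|) : Summable fun k => δ k * u k := by
  refine Summable.of_norm_bounded (hu.mul_left Z) fun k => ?_
  rw [Real.norm_eq_abs, abs_mul, ← mul_assoc]
  exact mul_le_mul_of_nonneg_right (hδ k) (abs_nonneg _)

theorem summable_pow_mul_abs_of_abs_le {r Z : ℝ} (hr0 : 0 ≤ r) (hr1 : r < 1) {δ : ℕ → ℝ}
    (hδ : ∀ k, |δ k| ≤ Z * r ^ k) : Summable fun k => r ^ k * |δ k| := by
  refine Summable.of_norm_bounded ((summable_geometric_of_lt_one hr0 hr1).mul_left Z) fun k => ?_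
  rw [Real.norm_of_nonneg (by positivity)]
  exact (mul_le_of_le_one_left (abs_nonneg _) (pow_le_one₀ hr0 hr1.le)).trans (hδ k)

/-- Pathwise, the initial values are forgotten: their effect `δ`, `η` on the two recursions decays
geometrically, and its contribution to the numerator and to the denominator of the estimator
converges, hence is negligible after normalization. -/
theorem tendsto_initial_value_terms {r Z ρ c : ℝ} (hr0 : 0 ≤ r) (hr1 : r < 1)
    {δ η y e ξ : ℕ → ℝ} (hb : ∀ k, |δ k| ≤ Z * r ^ k ∧ |η k| ≤ Z * r ^ k)
    (hy : Summable fun k => r ^ k * |y k|) (he : Summable fun k => r ^ k * |e k|)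
    (hξ : Summable fun k => r ^ k * |ξ k|) :
    Tendsto (fun n : ℕ => (n : ℝ)⁻¹ * ∑ k ∈ Finset.range n, (2 * (δ k * y k) + δ k * δ k))
        atTop (𝓝 0) ∧
      Tendsto (fun n : ℕ => (Real.sqrt n)⁻¹ * (∑ k ∈ Finset.range n, δ k * ξ k +
        ρ * (c + 2 * (δ n * y n) + δ n * δ n - δ n * e n - η n * y n - η n * δ n)))
        atTop (𝓝 0) := by
  have hδ : ∀ k, |δ k| ≤ Z * r ^ k := fun k => (hb k).1
  have hη : ∀ k, |η k| ≤ Z * r ^ k := fun k => (hb k).2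
  have hδs := summable_pow_mul_abs_of_abs_le hr0 hr1 hδ
  have s1 := summable_mul_of_abs_le hδ hy
  have s2 := summable_mul_of_abs_le hδ hδs
  have s3 := summable_mul_of_abs_le hδ he
  have s4 := summable_mul_of_abs_le hη hy
  have s5 := summable_mul_of_abs_le hη hδs
  have s6 := summable_mul_of_abs_le hδ hξ
  constructor
  · simpa using tendsto_inv_atTop_nhds_zero_nat.mul
      ((s1.mul_left 2).add s2).hasSum.tendsto_sum_nat
  · have hc : Tendsto (fun _ : ℕ => c) atTop (𝓝 c) := tendsto_const_nhds
    have := tendsto_inv_sqrt_natCast_atTop.mul (s6.hasSum.tendsto_sum_nat.add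
      ((((((hc.add (s1.tendsto_atTop_zero.const_mul 2)).add s2.tendsto_atTop_zero).sub
        s3.tendsto_atTop_zero).sub s4.tendsto_atTop_zero).sub s5.tendsto_atTop_zero).const_mul ρ))
    simpa using this

end InitialValues

/-! ### The least squares estimator -/

section LeastSquares

theorem thetaHat_eq_sum_range (x : ℕ → ℝ) (n : ℕ) :
    thetaHat x n = (∑ k ∈ Finset.range n, x (k + 1) * x k) / ∑ k ∈ Finset.range n, x k ^ 2 := by
  have : ∀ f : ℕ → ℝ, ∑ k ∈ Finset.Icc 1 n, f k = ∑ k ∈ Finset.range n, f (k + 1) := fun f => by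
    rw [Finset.range_eq_Ico, Finset.sum_Ico_add' f 0 n 1]
    rfl
  rw [thetaHat, this, this]
  simp

/-- Summing the recursion `x (k + 1) = (θ + ρ) x k - θ ρ x (k - 1) + v (k + 1)` against `x k`
isolates the martingale transform in the numerator of the estimator. -/
theorem sum_mul_succ_eq {θ ρ : ℝ} {x e v : ℕ → ℝ} (hx : ∀ n, x (n + 1) = θ * x n + e (n + 1))
    (he : ∀ n, e (n + 1) = ρ * e n + v (n + 1)) (n : ℕ) :
    (1 + θ * ρ) * ∑ k ∈ Finset.range n, x (k + 1) * x k =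
      (θ + ρ) * ∑ k ∈ Finset.range n, x k ^ 2 + ∑ k ∈ Finset.range n, v (k + 1) * x k +
        ρ * (e 0 * x 0 - x 0 ^ 2 + x n ^ 2 - e n * x n) := by
  induction n with
  | zero =>
    simp
  | succ n ih =>
    simp only [Finset.sum_range_succ]
    have h1 := hx n
    have h2 := he n
    rw [h1]
    rw [h2] at h1 ⊢
    linear_combination ih

theorem one_add_mul_pos {θ ρ : ℝ} (hθ : |θ| < 1) (hρ : |ρ| < 1) : 0 < 1 + θ * ρ := by
  have h3 : |θ * ρ| < 1 := by
    rw [abs_mul]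
    nlinarith [abs_nonneg θ, abs_nonneg ρ]
  linarith [(abs_lt.1 h3).1]

end LeastSquares

/-! ### Asymptotic normality -/

theorem theorem2p2 {Ω : Type*} [MeasurableSpace Ω] (μ : Measure Ω) [IsProbabilityMeasure μ]
    (θ ρ : ℝ) (hθ : |θ| < 1) (hρ : |ρ| < 1)
    (X ε V : ℕ → Ω → ℝ)
    -- the autoregressive process, with arbitrary random initial values
    (hX0 : AEMeasurable (X 0) μ) (hε0 : AEMeasurable (ε 0) μ)
    (hX : ∀ n ω, X (n + 1) ω = θ * X n ω + ε (n + 1) ω)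
    (hε : ∀ n ω, ε (n + 1) ω = ρ * ε n ω + V (n + 1) ω)
    -- `V 1, V 2, …` are i.i.d., centred, of positive variance, with a finite fourth moment
    (hVindep : iIndepFun (fun n : ℕ => V (n + 1)) μ)
    (hVident : ∀ n : ℕ, IdentDistrib (V (n + 1)) (V 1) μ μ)
    (hVmean : ∫ ω, V 1 ω ∂μ = 0)
    (hVvar : 0 < variance (V 1) μ)
    (hVmom : MemLp (V 1) 4 μ) :
    TendstoInDistribution
      (fun (n : ℕ) ω => Real.sqrt n * (thetaHat (fun k => X k ω) n - thetaStar θ ρ))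
      atTop (id : ℝ → ℝ) (fun _ => μ)
      (gaussianReal 0 (sigmaThetaSq θ ρ).toNNReal) := by
  have hVm : ∀ n, AEMeasurable (V (n + 1)) μ := fun n => (hVident n).aemeasurable_fst
  -- A genuinely measurable version of the noise, and its filtration.
  set ξ : ℕ → Ω → ℝ := fun n => (hVm n).mk (V (n + 1)) with hξdef
  have hξm : ∀ n, Measurable (ξ n) := fun n => (hVm n).measurable_mk
  have hξV : ∀ n, V (n + 1) =ᵐ[μ] ξ n := fun n => (hVm n).ae_eq_mk
  have hξid : ∀ n, IdentDistrib (ξ n) (V 1) μ μ := fun n =>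
    (IdentDistrib.of_ae_eq (hVm n) (hξV n)).symm.trans (hVident n)
  have h : IsInnovation (pastFiltration ξ hξm) ξ μ :=
    isInnovation_pastFiltration hξm (hVindep.congr hξV)
      (fun n => (hξid n).trans (hξid 0).symm) ((hξid 0).memLp_iff.2 hVmom)
      ((hξid 0).integral_eq.trans hVmean)
  set v : ℝ := ∫ ω, ξ 0 ω ^ 2 ∂μ with hv
  have hvpos : 0 < v := by
    rw [variance_of_integral_eq_zero (hVm 0) hVmean] at hVvar
    have : v = ∫ ω, V 1 ω ^ 2 ∂μ :=
      ((hξid 0).comp (u := fun x : ℝ => x ^ 2) (by fun_prop)).integral_eq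
    rw [this]
    exact hVvar
  -- The process started from zero.
  set e : ℕ → Ω → ℝ := arFilter ρ ξ with he
  set Y : ℕ → Ω → ℝ := arFilter θ (fun k => e (k + 1)) with hY
  have hem : ∀ k, Measurable[pastFiltration ξ hξm k] (e k) :=
    measurable_arFilter h.measurable_succ
  have hYm : ∀ k, Measurable[pastFiltration ξ hξm k] (Y k) :=
    measurable_arFilter fun k => hem (k + 1)
  have he4 : BoundedL4 e μ := h.boundedL4.arFilter hρ
  have hY4 : BoundedL4 Y μ := by
    obtain ⟨C, hC⟩ := he4
    exact BoundedL4.arFilter hθ ⟨C, fun k => hC (k + 1)⟩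
  have hYm' : ∀ k, Measurable (Y k) := fun k => (hYm k).mono (Filtration.le _ k) le_rfl
  set κ : ℝ := 1 + θ * ρ with hκ
  have hκ0 : 0 < κ := one_add_mul_pos hθ hρ
  set ℓ : ℝ := κ / ((1 - θ ^ 2) * (1 - θ * ρ) * (1 - ρ ^ 2)) * v with hℓ
  have hd1 : 0 < 1 - θ ^ 2 := by
    have := (sq_lt_one_iff_abs_lt_one θ).2 hθ
    linarith
  have hd2 : 0 < 1 - ρ ^ 2 := by
    have := (sq_lt_one_iff_abs_lt_one ρ).2 hρ
    linarith
  have hd3 : 0 < 1 - θ * ρ := by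
    have := one_add_mul_pos (θ := -θ) (by rwa [abs_neg]) hρ
    linarith
  have hℓ0 : 0 < ℓ := by positivity
  have hlln : TendstoInMeasure μ
      (fun (n : ℕ) ω => (n : ℝ)⁻¹ * ∑ k ∈ Finset.range n, Y k ω ^ 2) atTop (fun _ => ℓ) :=
    h.tendstoInMeasure_average_arFilter_sq hθ hρ he hY
  -- With the factor `1 / (κ ℓ)` put into the coefficients, the limit law is the claimed one.
  set b : ℝ := (κ * ℓ)⁻¹ with hb
  have hclt : TendstoInDistribution
      (fun (n : ℕ) ω => (Real.sqrt n)⁻¹ * ∑ k ∈ Finset.range n, b * Y k ω * ξ k ω)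
      atTop (id : ℝ → ℝ) (fun _ => μ) (gaussianReal 0 (sigmaThetaSq θ ρ).toNNReal) := by
    obtain ⟨C, hC⟩ := hY4.const_mul b
    have hlim := tendstoInMeasure_const_mul hlln (b ^ 2)
    have hvar : v * (b ^ 2 * ℓ) = sigmaThetaSq θ ρ := by
      rw [hb, hℓ, sigmaThetaSq, ← hκ]
      field_simp
    rw [← hvar]
    refine h.tendstoInDistribution_sum (U := fun k ω => b * Y k ω)
      (fun k => (hYm k).const_mul b) (fun k => (hC k).2.1) (fun k => (hC k).2.2)
      (by positivity) (hlim.congr_left fun n => ae_of_all _ fun ω => ?_)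
    simp only [mul_pow, ← Finset.mul_sum]
    ring
  -- Decay of the initial values.
  obtain ⟨r, hr⟩ : ∃ r, max |θ| |ρ| < r ∧ r < 1 := exists_between (max_lt hθ hρ)
  have hrθ : |θ| < r := (le_max_left _ _).trans_lt hr.1
  have hrρ : |ρ| < r := (le_max_right _ _).trans_lt hr.1
  have hr0 : 0 ≤ r := (abs_nonneg θ).trans hrθ.le
  have hsummable : ∀ {f : ℕ → Ω → ℝ}, BoundedL4 f μ →
      ∀ᵐ ω ∂μ, Summable fun k => r ^ k * |f k ω| := fun hf => by
    obtain ⟨K, hK⟩ := hf.integrable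
    exact ae_summable_pow_mul_abs hr0 hr.2 (fun n => (hK n).1) fun n => (hK n).2
  set S : ℕ → Ω → ℝ := fun n ω => ∑ k ∈ Finset.range n, X k ω ^ 2 with hS
  set P : ℕ → Ω → ℝ := fun n ω => ∑ k ∈ Finset.range n, X (k + 1) ω * X k ω with hP
  set N : ℕ → Ω → ℝ := fun n ω => P n ω - thetaStar θ ρ * S n ω with hN
  have hκN : ∀ n ω, κ * N n ω = ∑ k ∈ Finset.range n, V (k + 1) ω * X k ω +
      ρ * (ε 0 ω * X 0 ω - X 0 ω ^ 2 + X n ω ^ 2 - ε n ω * X n ω) := fun n ω => by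
    have hid := sum_mul_succ_eq (x := fun n => X n ω) (e := fun n => ε n ω)
      (v := fun n => V n ω) (fun n => hX n ω) (fun n => hε n ω) n
    have ht : κ * thetaStar θ ρ = θ + ρ := by
      rw [thetaStar, ← hκ]
      field_simp
    simp only [hN, hP, hS]
    linear_combination hid - (∑ k ∈ Finset.range n, X k ω ^ 2) * ht
  have hεm : ∀ n, AEMeasurable (ε n) μ := fun n => by
    induction n with
    | zero => exact hε0
    | succ n ih =>
      rw [show ε (n + 1) = fun ω => ρ * ε n ω + V (n + 1) ω from funext (hε n)]
      exact (ih.const_mul ρ).add (hVm n)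
  have hXm : ∀ n, AEMeasurable (X n) μ := fun n => by
    induction n with
    | zero => exact hX0
    | succ n ih =>
      rw [show X (n + 1) = fun ω => θ * X n ω + ε (n + 1) ω from funext (hX n)]
      exact (ih.const_mul θ).add (hεm (n + 1))
  have hSm : ∀ n, AEMeasurable (S n) μ := fun n => by fun_prop
  have hPm : ∀ n, AEMeasurable (P n) μ := fun n => by fun_prop
  have hNm : ∀ n, AEMeasurable (N n) μ := fun n => (hPm n).sub ((hSm n).const_mul _)
  -- The martingale transform for the process started from zero.
  set M : ℕ → Ω → ℝ := fun n ω => ∑ k ∈ Finset.range n, Y k ω * ξ k ω with hM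
  have hMm : ∀ n, Measurable (M n) := fun n => by fun_prop
  set B : ℕ → Ω → ℝ := fun n ω => Y n ω * Y n ω - e n ω * Y n ω with hB
  have hBm : ∀ n, Measurable (B n) := fun n => by
    have := (hem n).mono (Filtration.le _ n) le_rfl
    fun_prop
  have hpath : ∀ᵐ ω ∂μ,
      Tendsto (fun n : ℕ => (n : ℝ)⁻¹ * (S n ω - ∑ k ∈ Finset.range n, Y k ω ^ 2)) atTop (𝓝 0) ∧
      Tendsto (fun n : ℕ => (Real.sqrt n)⁻¹ * (κ * N n ω - M n ω - ρ * B n ω)) atTop (𝓝 0) := by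
    filter_upwards [ae_all_iff.2 hξV, hsummable hY4, hsummable he4, hsummable h.boundedL4]
      with ω hω sY se sξ
    set δ : ℕ → ℝ := fun k => X k ω - Y k ω with hδ
    set η : ℕ → ℝ := fun k => ε k ω - e k ω with hη
    have eS : ∀ k, e (k + 1) ω = ρ * e k ω + ξ k ω := fun k => rfl
    have YS : ∀ k, Y (k + 1) ω = θ * Y k ω + e (k + 1) ω := fun k => rfl
    have hηS : ∀ n, η (n + 1) = ρ * η n := fun n => by
      simp only [hη]
      rw [hε, hω, eS]
      ring
    have hδS : ∀ n, δ (n + 1) = θ * δ n + η (n + 1) := fun n => by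
      simp only [hη, hδ]
      rw [hX, YS]
      ring
    obtain ⟨Z, hZ⟩ := exists_abs_le_mul_pow hrθ hrρ.le hr.2.le hηS hδS
    obtain ⟨t1, t2⟩ := tendsto_initial_value_terms (ρ := ρ) (c := ε 0 ω * X 0 ω - X 0 ω ^ 2)
      hr0 hr.2 hZ sY se sξ
    constructor
    · refine t1.congr fun n => ?_
      rw [hS, ← Finset.sum_sub_distrib]
      congr 1
      refine Finset.sum_congr rfl fun k _ => ?_
      simp only [hδ]
      ring
    · refine t2.congr fun n => ?_
      have hsum : ∑ k ∈ Finset.range n, V (k + 1) ω * X k ω =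
          M n ω + ∑ k ∈ Finset.range n, δ k * ξ k ω := by
        rw [hM, ← Finset.sum_add_distrib]
        refine Finset.sum_congr rfl fun k _ => ?_
        rw [hω]
        simp only [hδ]
        ring
      rw [hκN, hsum]
      simp only [hB, hδ, hη]
      ring
  have hS1 : TendstoInMeasure μ (fun (n : ℕ) ω => (n : ℝ)⁻¹ * S n ω) atTop (fun _ => ℓ) := by
    have := tendstoInMeasure_add_const hlln (tendstoInMeasure_of_tendsto_ae
      (fun n => AEMeasurable.aestronglyMeasurable (by fun_prop)) (hpath.mono fun ω h => h.1))
    rw [add_zero] at this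
    refine this.congr_left fun n => ae_of_all _ fun ω => ?_
    simp only
    ring
  -- The numerator differs negligibly from the martingale transform.
  have hrem : TendstoInMeasure μ
      (fun (n : ℕ) ω => (Real.sqrt n)⁻¹ * (ℓ⁻¹ * N n ω - b * M n ω)) atTop (fun _ => 0) := by
    have hBound : TendstoInMeasure μ (fun (n : ℕ) ω => (Real.sqrt n)⁻¹ * B n ω) atTop
        (fun _ => 0) := by
      obtain ⟨K1, hK1⟩ := hY4.mul hY4
      obtain ⟨K2, hK2⟩ := he4.mul hY4
      have a1 := tendstoInMeasure_mul_of_integral_abs_le tendsto_inv_sqrt_natCast_atTop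
        (fun n => (hK1 n).1) fun n => (hK1 n).2
      have a2 := tendstoInMeasure_mul_of_integral_abs_le tendsto_inv_sqrt_natCast_atTop
        (fun n => (hK2 n).1) fun n => (hK2 n).2
      have := tendstoInMeasure_add_const a1 (tendstoInMeasure_const_mul a2 (-1))
      rw [mul_zero, add_zero] at this
      refine this.congr_left fun n => ae_of_all _ fun ω => ?_
      simp only [hB]
      ring
    have hG := tendstoInMeasure_of_tendsto_ae (μ := μ)
      (fun n => AEMeasurable.aestronglyMeasurable (by fun_prop)) (hpath.mono fun ω h => h.2)
    have := tendstoInMeasure_const_mul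
      (tendstoInMeasure_add_const hG (tendstoInMeasure_const_mul hBound ρ)) b
    rw [mul_zero, add_zero, mul_zero] at this
    refine this.congr_left fun n => ae_of_all _ fun ω => ?_
    have hbκ : b * κ = ℓ⁻¹ := by
      rw [hb]
      field_simp
    simp only
    rw [← hbκ]
    ring
  have hnum : TendstoInDistribution (fun (n : ℕ) ω => (Real.sqrt n)⁻¹ * (ℓ⁻¹ * N n ω))
      atTop (id : ℝ → ℝ) (fun _ => μ) (gaussianReal 0 (sigmaThetaSq θ ρ).toNNReal) := by
    refine tendstoInDistribution_of_tendstoInMeasure_sub _ _ hclt ?_ (fun n => by fun_prop)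
    refine hrem.congr (fun n => ae_of_all _ fun ω => ?_) (ae_of_all _ fun ω => rfl)
    simp only [Pi.sub_apply, hM, mul_assoc, ← Finset.mul_sum]
    ring
  have hden : TendstoInMeasure μ (fun (n : ℕ) ω => ℓ * ((n : ℝ)⁻¹ * S n ω)⁻¹) atTop
      (fun _ => 1) := by
    have hc : ContinuousAt (fun x : ℝ => ℓ * x⁻¹) ℓ :=
      continuousAt_const.mul (continuousAt_inv₀ hℓ0.ne')
    have := tendstoInMeasure_continuousAt_comp hS1 hc
    rwa [mul_inv_cancel₀ hℓ0.ne'] at this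
  have hprod := hnum.continuous_comp_prodMk_of_tendstoInMeasure_const
    (g := fun p : ℝ × ℝ => p.1 * p.2) (by fun_prop) hden (fun n => by fun_prop)
  have hTm : ∀ n : ℕ, AEMeasurable
      (fun ω => Real.sqrt n * (thetaHat (fun k => X k ω) n - thetaStar θ ρ)) μ := fun n => by
    simp only [thetaHat_eq_sum_range]
    exact (((hPm n).div (hSm n)).sub_const _).const_mul _
  -- The product above is the normalized error, except where the denominator vanishes.
  have hdiff : ∀ (n : ℕ) ω, S n ω ≠ 0 →
      Real.sqrt n * (thetaHat (fun k => X k ω) n - thetaStar θ ρ) =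
        (Real.sqrt n)⁻¹ * (ℓ⁻¹ * N n ω) * (ℓ * ((n : ℝ)⁻¹ * S n ω)⁻¹) := fun n ω hne => by
    have hn : 0 < n := Nat.pos_of_ne_zero fun h0 => hne (by simp [hS, h0])
    have hq : 0 < Real.sqrt n := Real.sqrt_pos.2 (by exact_mod_cast hn)
    have hn2 : (n : ℝ) = Real.sqrt n ^ 2 := (Real.sq_sqrt (Nat.cast_nonneg n)).symm
    have e1 : thetaHat (fun k => X k ω) n - thetaStar θ ρ = N n ω / S n ω := by
      rw [thetaHat_eq_sum_range, hN]
      change P n ω / S n ω - _ = _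
      field_simp
    rw [e1]
    generalize Real.sqrt n = q at *
    rw [hn2]
    field_simp
  have hfin := tendstoInDistribution_of_tendstoInMeasure_sub
    (fun (n : ℕ) ω => Real.sqrt n * (thetaHat (fun k => X k ω) n - thetaStar θ ρ)) _ hprod ?_ hTm
  · have hid : (fun x : ℝ => (id x, (1 : ℝ)).1 * (id x, (1 : ℝ)).2) = id := by
      ext x
      simp
    rwa [hid] at hfin
  rw [tendstoInMeasure_iff_dist] at hS1 ⊢
  intro a ha
  refine tendsto_of_tendsto_of_tendsto_of_le_of_le tendsto_const_nhds (hS1 ℓ hℓ0)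
    (fun _ => zero_le) fun n => measure_mono fun ω hω => ?_
  simp only [Set.mem_ofPred_eq, Pi.sub_apply, Pi.zero_apply] at hω ⊢
  by_contra! hlt
  have hne : S n ω ≠ 0 := fun h0 => by
    rw [h0, mul_zero, dist_zero_left, Real.norm_of_nonneg hℓ0.le] at hlt
    exact lt_irrefl _ hlt
  rw [hdiff n ω hne, sub_self, dist_self] at hω
  linarith
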